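/- **Lemma 4.9.** Let $[3]^n=\{0,1,2\}^n$ be ordered coordinatewise and, for $k\ge 0$, let $L_k$ be the set of $v\in[3]^n$ with $v_1+\dots+v_n=k$. In the Hasse diagram of $[3]^n$ (the graph in which $x,y$ are adjacent if one of them covers the other), for $v\in L_k$ let $N^+(v)$ be the set of neighbours of $v$ in $L_{k+1}$, and let $N^+(S)=\bigcup_{v\in S}N^+(v)$ for $S\subseteq[3]^n$. For $A\subseteq L_i$ let $[A]=\{v\in L_i: N^+(v)\subseteq N^+(A)\}$. Call $A\subseteq[3]^n$ *2-linked* if the graph on $A$ in which two distinct vertices are adjacent when their distance in the Hasse diagram of $[3]^n$ is at most $2$ is connected. For $n\ge2$ and integers $a,b,g,h$ let $\mathcal H(a,b,g,h)$ be the set of pairs $(A,B)$ with $A\subseteq L_{n-1}$, $B\subseteq L_{n-2}$ such that $A$ is 2-linked, $|[A]|=a$, $|[B]|=b$, $|N^+(A)|=g$, $|N^+(B)|=h$ and $N^+(B)\subseteq A$. There exist an absolute constant $c>0$ and an integer $n_0\ge 2$ such that for all $n\ge n_0$ and all integers $a,b,g,h$ with $0\le b\le h\le a\le g$ and $a\ge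 n^2$, $$|\mathcal H(a,b,g,h)|\le 2^{\,g-c\,(t+t')/\log_2 n},\qquad\text{where } t=g-a,\ t'=h-b.$$ -/

import Mathlib

namespace ThreeGrid

/-- The `k`-th power of a graph: distinct vertices are adjacent iff their distance in `G` is at most
`k` (vertices in different components are at distance `⊤`). -/
def graphPower {V : Type*} (G : SimpleGraph V) (k : ℕ) : SimpleGraph V where
  Adj u v := u ≠ v ∧ G.edist u v ≤ (k : ℕ∞)
  symm := ⟨fun _ _ h => ⟨h.1.symm, by rw [SimpleGraph.edist_comm]; exact h.2⟩⟩
  loopless := ⟨fun _ h => h.1 rfl⟩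

/-- A set of vertices is `k`-linked if it induces a connected subgraph of the `k`-th power. -/
def IsLinked {V : Type*} (G : SimpleGraph V) (k : ℕ) (A : Set V) : Prop :=
  ((graphPower G k).induce A).Connected

/-- The poset `[3]^n = {0,1,2}^n` with the coordinatewise order. -/
abbrev Grid (n : ℕ) : Type := Fin n → Fin 3

/-- The layer `L_k` of `[3]^n`: the points whose coordinates add up to `k`. -/
def layer (n k : ℕ) : Finset (Grid n) :=
  Finset.univ.filter fun v => ∑ i, (v i : ℕ) = k

open Classical in
/-- `N⁺(v)`: the neighbours of `v` in the Hasse diagram of `[3]^n` that lie in the next layer. -/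
noncomputable def upNbhd {n : ℕ} (v : Grid n) : Finset (Grid n) :=
  (layer n (∑ i, (v i : ℕ) + 1)).filter fun w => (SimpleGraph.hasse (Grid n)).Adj v w

open Classical in
/-- `N⁺(S)`, the union of the sets `N⁺(v)` with `v ∈ S`. -/
noncomputable def upNbhdSet {n : ℕ} (S : Finset (Grid n)) : Finset (Grid n) :=
  S.biUnion upNbhd

open Classical in
/-- The upwards closure `[A] = {v ∈ L_i : N⁺(v) ⊆ N⁺(A)}` of a set `A ⊆ L_i`. -/
noncomputable def upClosure {n : ℕ} (i : ℕ) (A : Finset (Grid n)) : Finset (Grid n) :=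
  (layer n i).filter fun v => upNbhd v ⊆ upNbhdSet A

open Classical in
/-- The family `𝓗(a,b,g,h)` of pairs `(A,B)` with `A ⊆ L_{n-1}`, `B ⊆ L_{n-2}`, `A` 2-linked in the
Hasse diagram of `[3]^n`, `|[A]| = a`, `|[B]| = b`, `|N⁺(A)| = g`, `|N⁺(B)| = h`, `N⁺(B) ⊆ A`.
(It is meant for `n ≥ 2`.) -/
noncomputable def containerPairs (n a b g h : ℕ) : Finset (Finset (Grid n) × Finset (Grid n)) :=
  ((layer n (n - 1)).powerset ×ˢ (layer n (n - 2)).powerset).filter fun P =>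
    IsLinked (SimpleGraph.hasse (Grid n)) 2 (P.1 : Set (Grid n)) ∧
      (upClosure (n - 1) P.1).card = a ∧ (upClosure (n - 2) P.2).card = b ∧
      (upNbhdSet P.1).card = g ∧ (upNbhdSet P.2).card = h ∧ upNbhdSet P.2 ⊆ P.1

end ThreeGrid

/-! The proof is a graph container argument. In the layers `L_{n-1}` and `L_{n-2}` every point
spreads unit mass evenly over its upper neighbours. Degrees do not increase upwards, so no point
receives more than `1`, and `t = g - a` is the total vacancy left on `N⁺(A)` by `[A]`. Hence `t`
controls all defects: at most `n * t` edges run down from `N⁺(A)` to points outside `[A]`.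

Approximation (`IsLevel.exists_certificate`). Write `l = log₂ n`. A certificate of `O(t * l / n +
n)` points determines sets `F ⊆ N⁺(A)` and `S ⊇ [A]` with `|S| ≤ |F| + t / (24 * l)`. It consists of
a sample of `N⁺(A)` with its corrections, followed by two greedy refinements. The sample is small
because `g = O(n * t)`. For `L_{n-2}` this expansion is a local count. For `L_{n-1}` it is delicate,
since the all-ones point of `L_n` can have vacancy `0`: an edge-isoperimetric inequality shows that
poorly expanding sets are exponentially large, and then most of their neighbours have many
coordinates equal to `2`, hence positive vacancy (`card_nbhd_le_of_layer_sub_one`).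

Reconstruction (`card_approximated_le`). Given `F` and `S`, either `S` is noticeably smaller than
`g`, and `A` is chosen inside `S`; or `F` misses few points of `N⁺(A)`, and after naming them `A` is
chosen inside `[A]`, which has only `a` points. Since `A` contains the `h` points of `N⁺(B)`, the
choice of `A` gains a factor `2^(-h)`, which pays for the choice of `B`. For fixed certificates this
leaves `2^(g - (t + t') / (24 * l))` pairs.

Cost. All certificate points lie near `A` and `A` is 2-linked, so the certificates form a linked set
and can be traced by a walk (`card_linked_tuples_le`). As `t ≥ n²` (`sq_le_gain`), counting them
consumes at most half of the saving. -/

namespace GraphContainer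

open Finset

/-! ### Mass transport between two consecutive levels. -/

/-- The share that `x` sends to each of its upper neighbours when its unit mass is split evenly. -/
noncomputable def share {V : Type*} (up : V → Finset V) (x : V) : ℝ := 1 / ((up x).card : ℝ)

lemma share_nonneg {V : Type*} {up : V → Finset V} (x : V) : 0 ≤ share up x := by
  unfold share; positivity

variable {V : Type*} [DecidableEq V]

/-- Two consecutive levels of a graded graph: every `x ∈ X` sits below the vertices of `up x`, all
degrees lie between `n / 3` and `n`, degrees do not increase upwards and two vertices of `X` have at
most one common upper neighbour. -/
structure IsLevel (up dn : V → Finset V) (X : Finset V) (n : ℕ) : Prop where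
  adj : ∀ x y, y ∈ up x ↔ x ∈ dn y
  dn_sub : ∀ x ∈ X, ∀ y ∈ up x, dn y ⊆ X
  up_card_le : ∀ x ∈ X, (up x).card ≤ n
  le_up_card : ∀ x ∈ X, n ≤ 3 * (up x).card
  le_dn_card : ∀ x ∈ X, ∀ y ∈ up x, n ≤ 3 * (dn y).card
  dn_le_up : ∀ x ∈ X, ∀ y ∈ up x, (dn y).card ≤ (up x).card
  codeg : ∀ x ∈ X, ∀ x' ∈ X, x ≠ x' → (up x ∩ up x').card ≤ 1

variable {up dn : V → Finset V} {X : Finset V} {n : ℕ}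

namespace IsLevel

lemma up_card_pos (h : IsLevel up dn X n) (hn : 0 < n) {x : V} (hx : x ∈ X) :
    0 < (up x).card := by
  have := h.le_up_card x hx
  omega

lemma share_le (h : IsLevel up dn X n) (hn : 0 < n) {x : V} (hx : x ∈ X) :
    share up x ≤ 3 / n := by
  have h1 := h.le_up_card x hx
  have h2 := h.up_card_pos hn hx
  have h1' : (n : ℝ) ≤ 3 * (up x).card := by exact_mod_cast h1
  have h2' : (0 : ℝ) < (up x).card := by exact_mod_cast h2
  have hn' : (0 : ℝ) < n := by exact_mod_cast hn
  unfold share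
  rw [div_le_div_iff₀ h2' hn']
  linarith

lemma le_share (h : IsLevel up dn X n) (hn : 0 < n) {x : V} (hx : x ∈ X) :
    1 / (n : ℝ) ≤ share up x := by
  have h1 := h.up_card_le x hx
  have h2 := h.up_card_pos hn hx
  have h1' : ((up x).card : ℝ) ≤ n := by exact_mod_cast h1
  have h2' : (0 : ℝ) < (up x).card := by exact_mod_cast h2
  unfold share
  exact one_div_le_one_div_of_le h2' h1'

lemma sum_up_share (h : IsLevel up dn X n) (hn : 0 < n) {x : V} (hx : x ∈ X) :
    ∑ _y ∈ up x, share up x = 1 := by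
  have h2' : (0 : ℝ) < (up x).card := by exact_mod_cast h.up_card_pos hn hx
  rw [sum_const, nsmul_eq_mul, share]
  field_simp

/-- Each lower neighbour of `y` has up-degree at least the down-degree of `y`, so it contributes at
most the reciprocal of that down-degree. -/
lemma sum_dn_share_le (h : IsLevel up dn X n) (hn : 0 < n) {x : V} (hx : x ∈ X) {y : V}
    (hy : y ∈ up x) : ∑ z ∈ dn y, share up z ≤ 1 := by
  have hd : 0 < (dn y).card := by have := h.le_dn_card x hx y hy; omega
  have hd' : (0 : ℝ) < (dn y).card := by exact_mod_cast hd
  calc ∑ z ∈ dn y, share up z ≤ ∑ z ∈ dn y, 1 / ((dn y).card : ℝ) := by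
        refine sum_le_sum fun z hz => ?_
        have hzX := h.dn_sub x hx y hy hz
        have := h.dn_le_up z hzX y ((h.adj z y).2 hz)
        unfold share
        exact one_div_le_one_div_of_le hd' (by exact_mod_cast this)
    _ = 1 := by rw [sum_const, nsmul_eq_mul]; field_simp

lemma sum_share_comm (h : IsLevel up dn X n) (S F : Finset V) :
    ∑ u ∈ S, ∑ _y ∈ up u ∩ F, share up u = ∑ y ∈ F, ∑ u ∈ dn y ∩ S, share up u := by
  refine sum_comm' fun u y => ?_
  simp only [mem_inter, h.adj]
  tauto

/-- The gain `|N(C)| - |C|` as a sum of the vacancies of the vertices of `N(C)`. -/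
lemma sum_vacancy (h : IsLevel up dn X n) (hn : 0 < n) {C : Finset V} (hC : C ⊆ X) :
    ∑ y ∈ C.biUnion up, (1 - ∑ x ∈ dn y ∩ C, share up x) =
      ((C.biUnion up).card : ℝ) - C.card := by
  rw [sum_sub_distrib, ← h.sum_share_comm]
  congr 1
  · simp
  · rw [card_eq_sum_ones, Nat.cast_sum]
    refine sum_congr rfl fun x hx => ?_
    rw [inter_eq_left.2 (subset_biUnion_of_mem up hx), h.sum_up_share hn (hC hx)]
    simp

/-- Letting all of `dn y` send mass only lowers the vacancy, and the resulting deficit depends on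
`y` alone. Pointwise lower bounds for it therefore give expansion. -/
lemma sum_deficit_le (h : IsLevel up dn X n) (hn : 0 < n) {C : Finset V} (hC : C ⊆ X) :
    ∑ y ∈ C.biUnion up, (1 - ∑ x ∈ dn y, share up x) ≤
      ((C.biUnion up).card : ℝ) - C.card := by
  rw [← h.sum_vacancy hn hC]
  refine sum_le_sum fun y _ => ?_
  have : ∑ x ∈ dn y ∩ C, share up x ≤ ∑ x ∈ dn y, share up x :=
    sum_le_sum_of_subset_of_nonneg inter_subset_left fun x _ _ => share_nonneg x
  linarith

lemma card_le_card_nbhd (h : IsLevel up dn X n) (hn : 0 < n) {C : Finset V} (hC : C ⊆ X) :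
    (C.card : ℝ) ≤ (C.biUnion up).card := by
  have h1 := h.sum_deficit_le hn hC
  have h2 : 0 ≤ ∑ y ∈ C.biUnion up, (1 - ∑ x ∈ dn y, share up x) := by
    refine sum_nonneg fun y hy => ?_
    obtain ⟨x, hx, hxy⟩ := mem_biUnion.1 hy
    linarith [h.sum_dn_share_le hn (hC hx) hxy]
  linarith

/-- The number of edges that leave `N(C)` downwards without ending in `C`. -/
lemma sum_card_dn_sdiff_le (h : IsLevel up dn X n) (hn : 0 < n) {C : Finset V} (hC : C ⊆ X) :
    ∑ y ∈ C.biUnion up, ((dn y \ C).card : ℝ) ≤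
      n * (((C.biUnion up).card : ℝ) - C.card) := by
  rw [← h.sum_vacancy hn hC, mul_sum]
  refine sum_le_sum fun y hy => ?_
  have hn' : (0 : ℝ) < n := by exact_mod_cast hn
  obtain ⟨x, hx, hxy⟩ := mem_biUnion.1 hy
  have h1 := h.sum_dn_share_le hn (hC hx) hxy
  have h2 : ∑ z ∈ dn y ∩ C, share up z + ∑ z ∈ dn y \ C, share up z = ∑ z ∈ dn y, share up z := sum_inter_add_sum_sdiff (dn y) C (share up)
  -- A lower neighbour outside `C` withholds a share of at least `1 / n`, so it costs that much
  -- vacancy.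
  have h3 : ((dn y \ C).card : ℝ) * (1 / n) ≤ ∑ z ∈ dn y \ C, share up z := by
    rw [← nsmul_eq_mul]
    refine card_nsmul_le_sum _ _ _ fun z hz => ?_
    exact h.le_share hn (h.dn_sub x (hC hx) y hxy (mem_sdiff.1 hz).1)
  have h4 : ((dn y \ C).card : ℝ) * (1 / n) ≤ 1 - ∑ z ∈ dn y ∩ C, share up z := by linarith
  calc ((dn y \ C).card : ℝ) = n * (((dn y \ C).card : ℝ) * (1 / n)) := by field_simp
    _ ≤ _ := mul_le_mul_of_nonneg_left h4 hn'.le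

/-- The mass of `S` landing in `F` is at most `|F|`; the rest travels along edges leaving `F` aside,
each carrying at most `3 / n`. -/
lemma card_le_card_add (h : IsLevel up dn X n) (hn : 0 < n) {S F : Finset V} (hS : S ⊆ X) :
    (S.card : ℝ) ≤ F.card + 3 / n * ∑ u ∈ S, ((up u \ F).card : ℝ) := by
  have h1 : (S.card : ℝ) = ∑ u ∈ S, ∑ _y ∈ up u, share up u := by
    rw [card_eq_sum_ones, Nat.cast_sum]
    exact sum_congr rfl fun x hx => by rw [h.sum_up_share hn (hS hx)]; simp
  have h2 : (S.card : ℝ) = ∑ u ∈ S, ∑ _y ∈ up u \ F, share up u +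
      ∑ u ∈ S, ∑ _y ∈ up u ∩ F, share up u := by
    rw [h1, ← sum_add_distrib]
    exact sum_congr rfl fun x _ => by
      rw [add_comm]; exact (sum_inter_add_sum_sdiff (up x) F fun _ => share up x).symm
  rw [h2, h.sum_share_comm, add_comm, mul_sum]
  refine add_le_add ?_ ?_
  · rw [card_eq_sum_ones, Nat.cast_sum]
    refine sum_le_sum fun y _ => ?_
    rcases (dn y ∩ S).eq_empty_or_nonempty with he | ⟨x, hx⟩
    · simp [he]
    · rw [mem_inter] at hx
      have := h.sum_dn_share_le hn (hS hx.2) ((h.adj x y).2 hx.1)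
      have h3 : ∑ z ∈ dn y ∩ S, share up z ≤ ∑ z ∈ dn y, share up z :=
        sum_le_sum_of_subset_of_nonneg inter_subset_left fun x _ _ => share_nonneg x
      push_cast
      linarith
  · refine sum_le_sum fun u hu => ?_
    rw [sum_const, nsmul_eq_mul, mul_comm]
    exact mul_le_mul_of_nonneg_right (h.share_le hn (hS hu)) (by positivity)

/-- Few vertices of `N(C)` have few lower neighbours in `C`. -/
lemma card_low_le (h : IsLevel up dn X n) (hn : 0 < n) {C : Finset V} (hC : C ⊆ X) :
    ((((C.biUnion up).filter fun y => 6 * (dn y ∩ C).card ≤ n).card : ℕ) : ℝ) ≤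
      6 * (((C.biUnion up).card : ℝ) - C.card) := by
  have hn' : (0 : ℝ) < n := by exact_mod_cast hn
  set low := (C.biUnion up).filter fun y => 6 * (dn y ∩ C).card ≤ n with hlow
  have h1 : (low.card : ℝ) * (n / 6) ≤ ∑ y ∈ C.biUnion up, ((dn y \ C).card : ℝ) := by
    calc (low.card : ℝ) * (n / 6) ≤ ∑ y ∈ low, ((dn y \ C).card : ℝ) := by
          rw [← nsmul_eq_mul]
          refine card_nsmul_le_sum _ _ _ fun y hy => ?_
          rw [hlow, mem_filter] at hy
          obtain ⟨x, hx, hxy⟩ := mem_biUnion.1 hy.1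
          have h2 := h.le_dn_card x (hC hx) y hxy
          have h3 := card_sdiff_add_card_inter (dn y) C
          -- The down-degree is at least `n / 3`, of which at most `n / 6` is used by `C`.
          have h4 : (n : ℝ) ≤ 6 * (dn y \ C).card := by
            have : n ≤ 6 * (dn y \ C).card := by omega
            exact_mod_cast this
          linarith
      _ ≤ _ := sum_le_sum_of_subset_of_nonneg (filter_subset _ _) fun _ _ _ => by positivity
  have h2 := h.sum_card_dn_sdiff_le hn hC
  have h3 : (low.card : ℝ) * n ≤ 6 * (((C.biUnion up).card : ℝ) - C.card) * n := by linarith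
  exact le_of_mul_le_mul_right h3 hn'

/-- Two points of `K` share no upper neighbour other than `y`, so the more than `n / 6` sets `up x`
without `y`, each of size at least `n / 6`, are disjoint. -/
lemma le_card_second_nbhd (h : IsLevel up dn X n) (hn : 6 ≤ n) {K : Finset V} (hK : K ⊆ X)
    {y : V} (hKy : K ⊆ dn y) (hc : n < 6 * K.card) :
    (n : ℝ) ^ 2 / 36 ≤ ((K.biUnion up).card : ℝ) := by
  have h1 : (K.biUnion fun x => (up x).erase y).card = ∑ x ∈ K, ((up x).erase y).card := by
    refine card_biUnion fun x hx x' hx' hne => ?_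
    refine disjoint_left.2 fun z hz hz' => ?_
    rw [mem_erase] at hz hz'
    have hyx := (h.adj x y).2 (hKy hx)
    have hyx' := (h.adj x' y).2 (hKy hx')
    have := h.codeg x (hK hx) x' (hK hx') hne
    exact hz.1 (card_le_one.1 this z (by simp [hz.2, hz'.2]) y (by simp [hyx, hyx']))
  have h2 : (K.biUnion fun x => (up x).erase y).card ≤ (K.biUnion up).card :=
    card_le_card (biUnion_mono fun x _ => erase_subset _ _)
  have h3 : K.card * n ≤ 6 * ∑ x ∈ K, ((up x).erase y).card := by
    rw [mul_sum, ← smul_eq_mul]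
    refine card_nsmul_le_sum _ _ _ fun x hx => ?_
    have h4 := h.le_up_card x (hK hx)
    have h5 := card_erase_of_mem ((h.adj x y).2 (hKy hx))
    omega
  have h4 : n * n ≤ 36 * (K.biUnion up).card := by nlinarith
  have h5 : (n : ℝ) * n ≤ 36 * (K.biUnion up).card := by exact_mod_cast h4
  nlinarith

end IsLevel

/-! ### Hitting sets and greedy covers. -/

/-- A set of few points that meets most members of a family of large sets and has small weight. -/
lemma exists_light_hitting_set (G : Finset V) (e : V → ℝ) (he : ∀ z, 0 ≤ e z) (M : V → Finset V)
    (m : ℝ) {α β : ℝ} (hβ : 0 ≤ β) (hG : G.Nonempty) (hmG : m ≤ G.card) (k : ℕ) :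
    ∀ Q : Finset V, (∀ y ∈ Q, M y ⊆ G ∧ m ≤ (M y).card) → 0 ≤ α →
    ∃ T ⊆ G, T.card ≤ k ∧
      α * ∑ z ∈ T, e z + β * ((Q.filter fun y => Disjoint (M y) T).card : ℝ) ≤
        α * (k * (∑ z ∈ G, e z) / G.card) + β * (Q.card * (1 - m / G.card) ^ k) := by
  have hg : (0 : ℝ) < G.card := by exact_mod_cast hG.card_pos
  induction k with
  | zero =>
    intro Q _ _
    exact ⟨∅, empty_subset _, by simp, by simp⟩
  | succ k ih =>
    intro Q hQ hα
    set r : ℝ := 1 - m / G.card with hr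
    have hr0 : 0 ≤ r := by
      rw [hr, sub_nonneg]; exact (div_le_one hg).2 hmG
    -- This derandomizes `k` uniform draws from `G`: some `z` does no worse than average for the
    -- combined cost of weight and expected later misses.
    have key : ∃ z ∈ G, α * e z + β * r ^ k * ((Q.filter fun y => z ∉ M y).card : ℝ) ≤
        α * ((∑ z ∈ G, e z) / G.card) + β * r ^ k * (Q.card * r) := by
      apply exists_le_of_sum_le hG
      rw [sum_add_distrib, ← mul_sum, ← mul_sum, sum_const, nsmul_eq_mul]
      have h1 : ∑ z ∈ G, ((Q.filter fun y => z ∉ M y).card : ℝ) ≤ Q.card * (G.card - m) := by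
        have : ∑ z ∈ G, ((Q.filter fun y => z ∉ M y).card : ℝ) =
            ∑ y ∈ Q, ((G.filter fun z => z ∉ M y).card : ℝ) := by
          simp only [card_filter, Nat.cast_sum]
          exact sum_comm
        rw [this, ← nsmul_eq_mul]
        refine sum_le_card_nsmul _ _ _ fun y hy => ?_
        obtain ⟨h2, h3⟩ := hQ y hy
        have h4 : (G.filter fun z => z ∉ M y) = G \ M y := by ext; simp
        rw [h4, cast_card_sdiff h2]
        linarith
      have h2 : (G.card : ℝ) * r = G.card - m := by rw [hr]; field_simp
      calc α * ∑ z ∈ G, e z + β * r ^ k * ∑ z ∈ G, ((Q.filter fun y => z ∉ M y).card : ℝ)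
          ≤ α * ∑ z ∈ G, e z + β * r ^ k * (Q.card * (G.card - m)) := by gcongr
        _ = _ := by rw [← h2]; field_simp
    obtain ⟨z, hz, hzle⟩ := key
    obtain ⟨T, hTG, hTk, hT⟩ := ih (Q.filter fun y => z ∉ M y)
      (fun y hy => hQ y (mem_filter.1 hy).1) hα
    refine ⟨insert z T, insert_subset hz hTG, (card_insert_le _ _).trans (by omega), ?_⟩
    have h3 : (Q.filter fun y => Disjoint (M y) (insert z T)) =
        (Q.filter fun y => z ∉ M y).filter fun y => Disjoint (M y) T := by
      ext y; simp [disjoint_insert_right, and_assoc]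
    have h4 : ∑ w ∈ insert z T, e w ≤ e z + ∑ w ∈ T, e w := by
      by_cases hzT : z ∈ T
      · rw [insert_eq_of_mem hzT]; linarith [he z]
      · rw [sum_insert hzT]
    rw [h3]
    have h5 := mul_le_mul_of_nonneg_left h4 hα
    have h6 : α * ((k + 1 : ℕ) * (∑ z ∈ G, e z) / G.card) =
        α * (k * (∑ z ∈ G, e z) / G.card) + α * ((∑ z ∈ G, e z) / G.card) := by
      push_cast; ring
    rw [h6, pow_succ]
    have h7 : β * (Q.card * (r ^ k * r)) = β * r ^ k * (Q.card * r) := by ring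
    rw [h7]
    have h8 : β * (((Q.filter fun y => z ∉ M y).card : ℝ) * r ^ k) =
      β * r ^ k * ((Q.filter fun y => z ∉ M y).card : ℝ) := by ring
    rw [h8] at hT
    linarith

lemma exists_hitting_set (G : Finset V) (e : V → ℝ) (he : ∀ z, 0 ≤ e z) (M : V → Finset V)
    (m : ℝ) (k : ℕ) (Q : Finset V) (hQ : ∀ y ∈ Q, M y ⊆ G ∧ m ≤ (M y).card)
    (hQG : Q ⊆ G) {p q : ℝ} (hp : 0 < p) (hq : 0 < q) (hkp : k * (∑ z ∈ G, e z) ≤ p * G.card)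
    (hkq : G.card * Real.exp (-(m * k / G.card)) ≤ q) :
    ∃ T ⊆ G, T.card ≤ k ∧ ∑ z ∈ T, e z ≤ 2 * p ∧
      ((Q.filter fun y => Disjoint (M y) T).card : ℝ) ≤ 2 * q := by
  rcases Q.eq_empty_or_nonempty with rfl | hQne
  · exact ⟨∅, empty_subset _, by simp, by simpa using hp.le, by simpa using hq.le⟩
  have hG : G.Nonempty := hQne.mono hQG
  have hg : (0 : ℝ) < G.card := by exact_mod_cast hG.card_pos
  have hmG : m ≤ G.card := by
    obtain ⟨y, hy⟩ := hQne
    exact (hQ y hy).2.trans (by exact_mod_cast card_le_card (hQ y hy).1)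
  -- The weights `q` and `p` make both terms of the potential at most `p * q`, so each quantity is
  -- within twice its target.
  obtain ⟨T, hTG, hTk, hT⟩ := exists_light_hitting_set G e he M m hp.le hG hmG k Q hQ hq.le
  refine ⟨T, hTG, hTk, ?_⟩
  have h1 : k * (∑ z ∈ G, e z) / G.card ≤ p := by rw [div_le_iff₀ hg]; exact hkp
  have h2 : Q.card * (1 - m / G.card) ^ k ≤ q := by
    refine le_trans ?_ hkq
    have h3 : (1 - m / (G.card : ℝ)) ^ k ≤ Real.exp (-(m * k / G.card)) := by
      have h4 : 0 ≤ 1 - m / (G.card : ℝ) := by rw [sub_nonneg]; exact (div_le_one hg).2 hmG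
      have h5 : 1 - m / (G.card : ℝ) ≤ Real.exp (-(m / G.card)) := by
        have := Real.add_one_le_exp (-(m / (G.card : ℝ))); linarith
      calc (1 - m / (G.card : ℝ)) ^ k ≤ Real.exp (-(m / G.card)) ^ k :=
            pow_le_pow_left₀ h4 h5 k
        _ = Real.exp (-(m * k / G.card)) := by rw [← Real.exp_nat_mul]; congr 1; ring
    have h6 : (Q.card : ℝ) ≤ G.card := by exact_mod_cast card_le_card hQG
    have h7 : 0 ≤ Real.exp (-(m * k / (G.card : ℝ))) := (Real.exp_pos _).le
    calc (Q.card : ℝ) * (1 - m / G.card) ^ k ≤ Q.card * Real.exp (-(m * k / G.card)) := by gcongr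
      _ ≤ _ := by gcongr
  have h3 : q * ∑ z ∈ T, e z + p * ((Q.filter fun y => Disjoint (M y) T).card : ℝ) ≤
      q * p + p * q :=
    hT.trans (add_le_add (mul_le_mul_of_nonneg_left h1 hq.le) (mul_le_mul_of_nonneg_left h2 hp.le))
  have h4 : 0 ≤ ∑ z ∈ T, e z := sum_nonneg fun z _ => he z
  have h5 : (0 : ℝ) ≤ ((Q.filter fun y => Disjoint (M y) T).card : ℝ) := by positivity
  constructor
  · have : q * ∑ z ∈ T, e z ≤ q * (2 * p) := by nlinarith
    exact le_of_mul_le_mul_left this hq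
  · have : p * ((Q.filter fun y => Disjoint (M y) T).card : ℝ) ≤ p * (2 * q) := by nlinarith
    exact le_of_mul_le_mul_left this hp

/-- A greedy cover: few members of a family cover all of its members up to `ψ` points each. -/
lemma exists_greedy_cover (P : Finset V) (f : V → Finset V) (F : Finset V) {ψ : ℝ} (hψ : 0 ≤ ψ) :
    ∃ U ⊆ P, ψ * U.card ≤ ((U.biUnion f \ F).card : ℝ) ∧
      ∀ x ∈ P, ((f x \ (F ∪ U.biUnion f)).card : ℝ) ≤ ψ := by
  classical
  -- A largest `U` that gains `ψ` new points per member on average; a further member adding more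
  -- than `ψ` would contradict maximality.
  set good := P.powerset.filter fun U => ψ * U.card ≤ ((U.biUnion f \ F).card : ℝ) with hgood
  have hne : good.Nonempty := ⟨∅, by simp [hgood]⟩
  obtain ⟨U, hU, hmax⟩ := exists_max_image good card hne
  rw [hgood, mem_filter, mem_powerset] at hU
  refine ⟨U, hU.1, hU.2, fun x hx => ?_⟩
  by_contra! hlt
  have hxU : x ∉ U := by
    intro hxU
    have : f x \ (F ∪ U.biUnion f) = ∅ := by
      rw [sdiff_eq_empty_iff_subset]
      exact (subset_biUnion_of_mem f hxU).trans subset_union_right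
    rw [this] at hlt
    simp at hlt
    linarith
  have hmem : insert x U ∈ good := by
    rw [hgood, mem_filter, mem_powerset]
    refine ⟨insert_subset hx hU.1, ?_⟩
    have h1 : (insert x U).biUnion f \ F = (U.biUnion f \ F) ∪ (f x \ (F ∪ U.biUnion f)) := by
      ext z; simp only [biUnion_insert, mem_sdiff, mem_union]; tauto
    have h2 : Disjoint (U.biUnion f \ F) (f x \ (F ∪ U.biUnion f)) := by
      rw [disjoint_left]; intro z; simp only [mem_sdiff, mem_union]; tauto
    rw [h1, card_union_of_disjoint h2, card_insert_of_notMem hxU]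
    push_cast
    linarith [hU.2]
  have := hmax _ hmem
  rw [card_insert_of_notMem hxU] at this
  omega

end GraphContainer

/-! ### Certificates and the approximations read off from them. -/

namespace GraphContainer

open Finset

variable {V : Type*} [DecidableEq V] {up dn : V → Finset V} {X : Finset V} {n : ℕ}

/-- The part of `N(C)` that is read off from a certificate: `P 0` is a sample of `N(C)`, `P 1` the
lower neighbours of the sample outside `C`, `P 2` the missed vertices of `N(C)` and `P 3` a greedy
choice in `C`. -/
def core (up dn : V → Finset V) (P : Fin 5 → Finset V) : Finset V :=
  ((P 0).biUnion dn \ P 1).biUnion up ∪ P 2 ∪ (P 3).biUnion up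

/-- The vertices of `X` with at most `ψ` upper neighbours outside `F`. -/
noncomputable def hull (up : V → Finset V) (X : Finset V) (ψ : ℝ) (F : Finset V) : Finset V :=
  X.filter fun x => ((up x \ F).card : ℝ) ≤ ψ

/-- The superset of `C` determined by a certificate. -/
noncomputable def outer (up dn : V → Finset V) (X : Finset V) (ψ : ℝ) (P : Fin 5 → Finset V) :
    Finset V :=
  hull up X ψ (core up dn P) \ (P 4).biUnion dn

/-- The subset of `N(C)` determined by a certificate. -/
noncomputable def inner (up dn : V → Finset V) (X : Finset V) (ψ : ℝ) (P : Fin 5 → Finset V) :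
    Finset V :=
  core up dn P ∪ ((outer up dn X ψ P).biUnion up).filter
    fun y => ψ < ((dn y ∩ outer up dn X ψ P).card : ℝ)

namespace IsLevel

lemma sum_card_up_inter (h : IsLevel up dn X n) (S F : Finset V) :
    ∑ x ∈ S, ((up x ∩ F).card : ℝ) = ∑ y ∈ F, ((dn y ∩ S).card : ℝ) := by
  simp only [card_eq_sum_ones, Nat.cast_sum]
  refine sum_comm' fun u y => ?_
  simp only [mem_inter, h.adj]
  tauto

/-- The vertices outside `C` most of whose upper neighbours lie in `N(C)` are few. -/
lemma card_hull_sdiff_le (h : IsLevel up dn X n) (hn : 0 < n) {C F : Finset V} (hC : C ⊆ X)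
    (hF : F ⊆ C.biUnion up) {ψ : ℝ} (hψ : ψ ≤ n / 6) :
    ((hull up X ψ F \ C).card : ℝ) ≤ 6 * (((C.biUnion up).card : ℝ) - C.card) := by
  have hn' : (0 : ℝ) < n := by exact_mod_cast hn
  -- Up-degree at least `n / 3` and at most `ψ ≤ n / 6` neighbours outside `F` leave `n / 6` edges
  -- into `N(C)`. These are counted against the `n * t` edges that leave `N(C)` without ending in
  -- `C`.
  have h1 : ((hull up X ψ F \ C).card : ℝ) * (n / 6) ≤
      ∑ x ∈ hull up X ψ F \ C, ((up x ∩ C.biUnion up).card : ℝ) := by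
    rw [← nsmul_eq_mul]
    refine card_nsmul_le_sum _ _ _ fun x hx => ?_
    rw [mem_sdiff, hull, mem_filter] at hx
    have h2 : (n : ℝ) ≤ 3 * (up x).card := by exact_mod_cast h.le_up_card x hx.1.1
    have h3 : ((up x \ F).card : ℝ) + (up x ∩ F).card = (up x).card := by
      exact_mod_cast card_sdiff_add_card_inter (up x) F
    have h4 : ((up x ∩ F).card : ℝ) ≤ (up x ∩ C.biUnion up).card := by
      exact_mod_cast card_le_card (inter_subset_inter_left hF)
    linarith [hx.1.2]
  rw [h.sum_card_up_inter] at h1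
  have h2 : ∑ y ∈ C.biUnion up, ((dn y ∩ (hull up X ψ F \ C)).card : ℝ) ≤
      ∑ y ∈ C.biUnion up, ((dn y \ C).card : ℝ) := by
    refine sum_le_sum fun y _ => ?_
    have : dn y ∩ (hull up X ψ F \ C) ⊆ dn y \ C := by
      intro z; simp only [mem_inter, mem_sdiff]; tauto
    exact_mod_cast card_le_card this
  have h3 := h.sum_card_dn_sdiff_le hn hC
  have h4 : ((hull up X ψ F \ C).card : ℝ) * n ≤
      6 * (((C.biUnion up).card : ℝ) - C.card) * n := by linarith
  exact le_of_mul_le_mul_right h4 hn'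

lemma sample_size_mul_le {g l r t k N E : ℝ} (hN : 0 < N) (ht : 0 ≤ t) (htg : t ≤ g) (hr : 0 ≤ r)
    (hl : r ≤ l) (hk : k ≤ 72 * g * r / N ^ 2 + 1) (hE : E ≤ N * t) (hE0 : 0 ≤ E) :
    k * E ≤ (72 * (t * l / N) + N) * g := by
  have hg : 0 ≤ g := ht.trans htg
  calc k * E ≤ (72 * g * r / N ^ 2 + 1) * (N * t) := by gcongr
    _ = 72 * (t * r / N) * g + N * t := by field_simp
    _ ≤ 72 * (t * l / N) * g + N * g := by gcongr
    _ = _ := by ring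

lemma missed_le {g t k N κ : ℝ} (hN : 0 < N) (hg : 0 ≤ g) (ht : 0 ≤ t) (hκ : 0 ≤ κ)
    (hk : 72 * g * Real.log N / N ^ 2 ≤ k) (hgt : g ≤ κ * N * t) :
    g * Real.exp (-(N ^ 2 / 36 * k / g)) ≤ κ * (t / N) + 1 := by
  rcases hg.eq_or_lt with h0 | hg
  · rw [← h0, zero_mul]; positivity
  have h1 : 2 * Real.log N ≤ N ^ 2 / 36 * k / g := by
    rw [le_div_iff₀ hg]
    calc 2 * Real.log N * g = N ^ 2 / 36 * (72 * g * Real.log N / N ^ 2) := by field_simp; ring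
      _ ≤ _ := by gcongr
  have h2 : Real.exp (-(N ^ 2 / 36 * k / g)) ≤ 1 / N ^ 2 := by
    calc Real.exp (-(N ^ 2 / 36 * k / g)) ≤ Real.exp (-(2 * Real.log N)) := by
          gcongr
      _ = 1 / N ^ 2 := by
          rw [Real.exp_neg, two_mul, Real.exp_add, Real.exp_log hN, one_div, sq]
  calc g * Real.exp (-(N ^ 2 / 36 * k / g)) ≤ (κ * N * t) * (1 / N ^ 2) := by gcongr
    _ = κ * (t / N) := by field_simp
    _ ≤ _ := by linarith

/-- A small sample of `N(C)` together with its corrections. -/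
lemma exists_sample (h : IsLevel up dn X n) (hn : 6 ≤ n) {C : Finset V} (hC : C ⊆ X)
    {κ l : ℝ} (hκ : 0 ≤ κ) (hl : Real.log n ≤ l)
    (hgt : ((C.biUnion up).card : ℝ) ≤ κ * n * (((C.biUnion up).card : ℝ) - C.card)) :
    ∃ T ⊆ C.biUnion up, ∃ T' ⊆ C.biUnion up,
      (∀ y ∈ C.biUnion up, n < 6 * (dn y ∩ C).card →
        y ∈ (T.biUnion dn ∩ C).biUnion up ∪ T') ∧
      (T.card : ℝ) ≤ 72 * κ * ((((C.biUnion up).card : ℝ) - C.card) * l / n) + 1 ∧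
      ((T.biUnion dn \ C).card : ℝ) ≤
        144 * ((((C.biUnion up).card : ℝ) - C.card) * l / n) + 2 * n ∧
      (T'.card : ℝ) ≤ 2 * κ * ((((C.biUnion up).card : ℝ) - C.card) / n) + 2 := by
  have hn0 : 0 < n := by omega
  have hn' : (0 : ℝ) < n := by exact_mod_cast hn0
  have ht0 : 0 ≤ ((C.biUnion up).card : ℝ) - C.card := by
    have := h.card_le_card_nbhd hn0 hC; linarith
  have htg : ((C.biUnion up).card : ℝ) - C.card ≤ (C.biUnion up).card := by
    have : (0 : ℝ) ≤ C.card := by positivity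
    linarith
  have hE := h.sum_card_dn_sdiff_le hn0 hC
  generalize hG : C.biUnion up = G at *
  generalize ht : (G.card : ℝ) - C.card = t at *
  have hl0 : 0 ≤ Real.log n := Real.log_natCast_nonneg n
  have hl0' : 0 ≤ l := hl0.trans hl
  -- With `k` draws, a target set of size `n² / 36` in `G` is missed with probability at most
  -- `exp(-2 log n) = 1 / n²`.
  obtain ⟨k, hk1, hk2⟩ : ∃ k : ℕ, 72 * G.card * Real.log n / (n : ℝ) ^ 2 ≤ k ∧
      (k : ℝ) ≤ 72 * G.card * Real.log n / (n : ℝ) ^ 2 + 1 :=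
    ⟨_, Nat.le_ceil _, (Nat.ceil_lt_add_one (by positivity)).le⟩
  have hE0 : 0 ≤ ∑ y ∈ G, ((dn y \ C).card : ℝ) := sum_nonneg fun _ _ => Nat.cast_nonneg _
  have hp : 0 < 72 * (t * l / n) + n := by positivity
  have hq : 0 < κ * (t / n) + 1 := by positivity
  have hM : ∀ y ∈ G.filter (fun y => n < 6 * (dn y ∩ C).card), (dn y ∩ C).biUnion up ⊆ G ∧
      (n : ℝ) ^ 2 / 36 ≤ ((dn y ∩ C).biUnion up).card := by
    intro y hy
    rw [← hG]
    exact ⟨biUnion_subset_biUnion_of_subset_left _ inter_subset_right,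
      h.le_card_second_nbhd hn (inter_subset_right.trans hC) inter_subset_left
        (mem_filter.1 hy).2⟩
  obtain ⟨T, hTG, hTk, hTe, hTm⟩ := exists_hitting_set G (fun y => ((dn y \ C).card : ℝ))
    (fun _ => Nat.cast_nonneg _) (fun y => (dn y ∩ C).biUnion up) ((n : ℝ) ^ 2 / 36) k
    (G.filter fun y => n < 6 * (dn y ∩ C).card) hM (filter_subset _ _) hp hq
    (sample_size_mul_le hn' ht0 htg hl0 hl hk2 hE hE0)
    (missed_le hn' (Nat.cast_nonneg _) ht0 hκ hk1 hgt)
  -- `T'` collects the rich points whose second neighbourhood through `C` avoids `T`. Any other rich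
  -- `y` shares a lower neighbour in `C` with a sampled point.
  refine ⟨T, hTG, (G.filter fun y => n < 6 * (dn y ∩ C).card).filter
    fun y => Disjoint ((dn y ∩ C).biUnion up) T,
    (filter_subset _ _).trans (filter_subset _ _), ?_, ?_, ?_, ?_⟩
  · intro y hy hyn
    by_cases hd : Disjoint ((dn y ∩ C).biUnion up) T
    · exact mem_union_right _ (mem_filter.2 ⟨mem_filter.2 ⟨hy, hyn⟩, hd⟩)
    · rw [not_disjoint_iff] at hd
      obtain ⟨z, hz, hzT⟩ := hd
      obtain ⟨x, hx, hxz⟩ := mem_biUnion.1 hz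
      rw [mem_inter] at hx
      refine mem_union_left _ (mem_biUnion.2 ⟨x, mem_inter.2 ⟨mem_biUnion.2 ⟨z, hzT, ?_⟩, hx.2⟩, ?_⟩)
      · exact (h.adj x z).1 hxz
      · exact (h.adj x y).2 hx.1
  · calc (T.card : ℝ) ≤ k := by exact_mod_cast hTk
      _ ≤ 72 * G.card * Real.log n / (n : ℝ) ^ 2 + 1 := hk2
      _ ≤ 72 * (κ * n * t) * l / (n : ℝ) ^ 2 + 1 := by gcongr
      _ = _ := by field_simp
  · calc ((T.biUnion dn \ C).card : ℝ) ≤ ∑ z ∈ T, ((dn z \ C).card : ℝ) := by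
          have h1 : T.biUnion dn \ C = T.biUnion fun z => dn z \ C := by
            ext z; simp only [mem_sdiff, mem_biUnion]; tauto
          rw [h1]
          exact_mod_cast card_biUnion_le
      _ ≤ _ := hTe
      _ = _ := by ring
  · calc _ ≤ _ := hTm
      _ = _ := by ring

/-- Every `C ⊆ X` has a short certificate near `C` from which tight inner and outer approximations
of `N(C)` and `C` can be reconstructed. -/
lemma exists_certificate (h : IsLevel up dn X n) (hn : 6 ≤ n) {C : Finset V} (hC : C ⊆ X)
    {κ l : ℝ} (hκ : 0 ≤ κ) (hl : Real.log n ≤ l) (hl1 : 1 ≤ l)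
    (hgt : ((C.biUnion up).card : ℝ) ≤ κ * n * (((C.biUnion up).card : ℝ) - C.card)) :
    ∃ P : Fin 5 → Finset V,
      P 0 ⊆ C.biUnion up ∧ P 1 ⊆ (P 0).biUnion dn ∧ P 2 ⊆ C.biUnion up ∧ P 3 ⊆ C ∧
      (∀ y ∈ P 4, ∃ x ∈ X, y ∈ up x ∧ (up x ∩ C.biUnion up).Nonempty) ∧
      (∀ x ∈ C, (up x ∩ core up dn P).Nonempty) ∧
      (∑ i, ((P i).card : ℝ)) ≤
        (74 * κ + 10512) * ((((C.biUnion up).card : ℝ) - C.card) * l / n) + 3 * n ∧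
      inner up dn X (n / (864 * l)) P ⊆ C.biUnion up ∧ C ⊆ outer up dn X (n / (864 * l)) P ∧
      ((outer up dn X (n / (864 * l)) P).card : ℝ) ≤ (inner up dn X (n / (864 * l)) P).card +
        (((C.biUnion up).card : ℝ) - C.card) / (24 * l) := by
  have hn0 : 0 < n := by omega
  have hn6 : (6 : ℝ) ≤ n := by exact_mod_cast hn
  have hn' : (0 : ℝ) < n := by linarith
  have hl0 : 0 < l := by linarith
  obtain ⟨T, hTG, T', hTG', hcov, hTc, hΩc, hTc'⟩ := h.exists_sample hn hC hκ hl hgt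
  -- Chosen so that the final error `3 / n * (12 * t * ψ)` equals `t / (24 * l)`.
  set ψ : ℝ := n / (864 * l) with hψ
  have hψ0 : 0 < ψ := by positivity
  have hψn : ψ ≤ n / 6 := by
    rw [hψ]; gcongr; linarith
  set G := C.biUnion up with hG
  set t : ℝ := (G.card : ℝ) - C.card with ht
  have ht0 : 0 ≤ t := by have := h.card_le_card_nbhd hn0 hC; linarith
  set L := (T.biUnion dn ∩ C).biUnion up with hL
  have hLG : L ⊆ G := biUnion_subset_biUnion_of_subset_left _ inter_subset_right
  have hlow : ∀ F : Finset V, (∀ y ∈ G, n < 6 * (dn y ∩ C).card → y ∈ F) →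
      ((G \ F).card : ℝ) ≤ 6 * t := by
    intro F hF
    refine le_trans ?_ (h.card_low_le hn0 hC)
    have : G \ F ⊆ G.filter fun y => 6 * (dn y ∩ C).card ≤ n := by
      intro y hy
      rw [mem_sdiff] at hy
      refine mem_filter.2 ⟨hy.1, ?_⟩
      by_contra! hlt
      exact hy.2 (hF y hy.1 hlt)
    exact_mod_cast card_le_card this
  -- At most `6 * t` points of `G` are still uncovered, so `|U| ≤ 6 * t / ψ`; afterwards each point
  -- of `C` has at most `ψ` upper neighbours outside `F₁`.
  obtain ⟨U, hUC, hUc, hU⟩ := exists_greedy_cover C up (L ∪ T') hψ0.le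
  have hUG : U.biUnion up ⊆ G := biUnion_subset_biUnion_of_subset_left _ hUC
  have hUt : ψ * U.card ≤ 6 * t := by
    refine hUc.trans (le_trans ?_ (hlow (L ∪ T') hcov))
    exact_mod_cast card_le_card (sdiff_subset_sdiff hUG (subset_refl _))
  set F₁ := L ∪ T' ∪ U.biUnion up with hF₁
  have hF₁G : F₁ ⊆ G := union_subset (union_subset hLG hTG') hUG
  set S₁ := hull up X ψ F₁ with hS₁
  have hS₁C : ((S₁ \ C).card : ℝ) ≤ 6 * t := h.card_hull_sdiff_le hn0 hC hF₁G hψn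
  -- Points outside `G` have no lower neighbour in `C`, so deleting the lower neighbours of `W` from
  -- `S₁` is harmless. Afterwards every point outside `G` sees at most `ψ` points of `S`.
  obtain ⟨W, hWP, hWc, hW⟩ := exists_greedy_cover (S₁.biUnion up \ G) (fun y => dn y ∩ S₁) ∅ hψ0.le
  have hWC : ∀ y, y ∉ G → ∀ x ∈ dn y, x ∉ C := fun y hy x hx hxC =>
    hy (mem_biUnion.2 ⟨x, hxC, (h.adj x y).2 hx⟩)
  have hWt : ψ * W.card ≤ 6 * t := by
    refine hWc.trans (le_trans ?_ hS₁C)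
    have : (W.biUnion fun y => dn y ∩ S₁) \ ∅ ⊆ S₁ \ C := by
      intro x hx
      rw [sdiff_empty] at hx
      obtain ⟨y, hy, hxy⟩ := mem_biUnion.1 hx
      rw [mem_inter] at hxy
      exact mem_sdiff.2 ⟨hxy.2, hWC y (mem_sdiff.1 (hWP hy)).2 x hxy.1⟩
    exact_mod_cast card_le_card this
  set P : Fin 5 → Finset V := ![T, T.biUnion dn \ C, T', U, W] with hP
  -- Removing `P 1`, the part outside `C`, from the lower neighbours of `T` recovers the part inside
  -- `C`.
  have hcore : core up dn P = F₁ := by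
    have h1 : core up dn P = (T.biUnion dn \ (T.biUnion dn \ C)).biUnion up ∪ T' ∪ U.biUnion up :=
      rfl
    rw [h1, sdiff_sdiff_self_left]
  have houter : outer up dn X ψ P = S₁ \ W.biUnion dn := by
    rw [outer, hcore]; rfl
  set S := S₁ \ W.biUnion dn with hS
  have hinner : inner up dn X ψ P =
      F₁ ∪ (S.biUnion up).filter fun y => ψ < ((dn y ∩ S).card : ℝ) := by
    rw [inner, hcore, houter]
  have hSX : S ⊆ X := sdiff_subset.trans (filter_subset _ _)
  have hSn : ∀ y ∈ S.biUnion up, y ∉ G → ((dn y ∩ S).card : ℝ) ≤ ψ := by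
    intro y hy hyG
    refine le_trans ?_ (hW y (mem_sdiff.2
      ⟨biUnion_subset_biUnion_of_subset_left _ sdiff_subset hy, hyG⟩))
    have : dn y ∩ S ⊆ (dn y ∩ S₁) \ (∅ ∪ W.biUnion fun y => dn y ∩ S₁) := by
      intro x hx
      simp only [hS, mem_inter, mem_sdiff, mem_biUnion, empty_union, not_exists, not_and] at hx ⊢
      exact ⟨⟨hx.1, hx.2.1⟩, fun z hz hxz => absurd hxz (hx.2.2 z hz)⟩
    exact_mod_cast card_le_card this
  set F := F₁ ∪ (S.biUnion up).filter fun y => ψ < ((dn y ∩ S).card : ℝ) with hF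
  have hFG : F ⊆ G := by
    refine union_subset hF₁G fun y hy => ?_
    rw [mem_filter] at hy
    by_contra hyG
    exact absurd (hSn y hy.1 hyG) (not_le.2 hy.2)
  have hCS₁ : ∀ x ∈ C, ((up x \ F₁).card : ℝ) ≤ ψ := hU
  have hCS : C ⊆ S := by
    intro x hx
    refine mem_sdiff.2 ⟨mem_filter.2 ⟨hC hx, hCS₁ x hx⟩, fun hxW => ?_⟩
    obtain ⟨y, hy, hxy⟩ := mem_biUnion.1 hxW
    exact hWC y (mem_sdiff.1 (hWP hy)).2 x hxy hx
  have hmeet : ∀ x ∈ X, ((up x \ F₁).card : ℝ) ≤ ψ → (up x ∩ F₁).Nonempty := by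
    intro x hx hxψ
    rw [nonempty_iff_ne_empty]
    intro he
    have h2 : (n : ℝ) ≤ 3 * (up x).card := by exact_mod_cast h.le_up_card x hx
    have h3 : ((up x \ F₁).card : ℝ) + (up x ∩ F₁).card = (up x).card := by
      exact_mod_cast card_sdiff_add_card_inter (up x) F₁
    rw [he] at h3
    simp only [card_empty, Nat.cast_zero] at h3
    linarith
  refine ⟨P, hTG, sdiff_subset, hTG', hUC, ?_, ?_, ?_, ?_, ?_, ?_⟩
  · intro y hy
    obtain ⟨x, hx, hxy⟩ := mem_biUnion.1 (mem_sdiff.1 (hWP hy)).1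
    have hx' := mem_filter.1 hx
    exact ⟨x, hx'.1, hxy, (hmeet x hx'.1 hx'.2).mono (inter_subset_inter_left hF₁G)⟩
  · intro x hx
    rw [hcore]
    exact hmeet x (hC hx) (hCS₁ x hx)
  · have h1 : ∑ i, ((P i).card : ℝ) =
        T.card + (T.biUnion dn \ C).card + T'.card + U.card + W.card := by
      rw [Fin.sum_univ_five]; rfl
    have h2 : ∀ m : ℝ, ψ * m ≤ 6 * t → m ≤ 5184 * (t * l / n) := by
      intro m hm
      have h3 : ψ * m ≤ ψ * (5184 * (t * l / n)) := by
        refine hm.trans (le_of_eq ?_)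
        rw [hψ]; field_simp; ring
      exact le_of_mul_le_mul_left h3 hψ0
    have h3 := h2 _ hUt
    have h4 := h2 _ hWt
    have h5 : κ * (t / n) ≤ κ * (t * l / n) := by
      gcongr; nlinarith
    rw [h1]
    linarith
  · rw [hinner]; exact hFG
  · rw [houter]; exact hCS
  · rw [hinner, houter]
    have h1 := h.card_le_card_add hn0 (F := F) hSX
    -- Edges from `S` that miss `F` end in `G \ F`, which has at most `6 * t` points seeing at most
    -- `ψ` points of `S` each, or outside `G`. The latter start in `S \ C`, which has at most `6 *
    -- t` points with at most `ψ` such edges each.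
    have h2 : ∑ u ∈ S, ((up u \ F).card : ℝ) ≤ 12 * t * ψ := by
      have h3 : ∀ u ∈ S, ((up u \ F).card : ℝ) ≤
          ((up u ∩ (G \ F)).card : ℝ) + ((up u \ G).card : ℝ) := by
        intro u _
        have : up u \ F ⊆ (up u ∩ (G \ F)) ∪ (up u \ G) := by
          intro y; simp only [mem_sdiff, mem_union, mem_inter]; tauto
        exact_mod_cast (card_le_card this).trans (card_union_le _ _)
      have h4 : ∑ u ∈ S, ((up u ∩ (G \ F)).card : ℝ) ≤ 6 * t * ψ := by
        rw [h.sum_card_up_inter]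
        have h5 : ∑ y ∈ G \ F, ((dn y ∩ S).card : ℝ) ≤ (G \ F).card * ψ := by
          rw [← nsmul_eq_mul]
          refine sum_le_card_nsmul _ _ _ fun y hy => ?_
          by_contra! hlt
          rw [mem_sdiff] at hy
          refine hy.2 (mem_union_right _ (mem_filter.2 ⟨?_, hlt⟩))
          have hne : (dn y ∩ S).Nonempty := by
            rw [nonempty_iff_ne_empty]
            intro he
            rw [he] at hlt
            simp at hlt
            linarith
          obtain ⟨x, hx⟩ := hne
          rw [mem_inter] at hx
          exact mem_biUnion.2 ⟨x, hx.2, (h.adj x y).2 hx.1⟩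
        refine h5.trans (mul_le_mul_of_nonneg_right (hlow F fun y hy hyn => ?_) hψ0.le)
        exact mem_union_left _ (mem_union_left _ (hcov y hy hyn))
      have h6 : ∑ u ∈ S, ((up u \ G).card : ℝ) ≤ 6 * t * ψ := by
        have h7 : ∑ u ∈ S, ((up u \ G).card : ℝ) = ∑ u ∈ S \ C, ((up u \ G).card : ℝ) := by
          refine (sum_subset sdiff_subset fun u hu hu' => ?_).symm
          have huC : u ∈ C := by
            by_contra hc; exact hu' (mem_sdiff.2 ⟨hu, hc⟩)
          rw [sdiff_eq_empty_iff_subset.2 (subset_biUnion_of_mem up huC)]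
          simp
        rw [h7]
        have h8 : ∑ u ∈ S \ C, ((up u \ G).card : ℝ) ≤ (S \ C).card * ψ := by
          rw [← nsmul_eq_mul]
          refine sum_le_card_nsmul _ _ _ fun u hu => ?_
          have hu' := mem_filter.1 (mem_sdiff.1 (mem_sdiff.1 hu).1).1
          refine le_trans ?_ hu'.2
          exact_mod_cast card_le_card (sdiff_subset_sdiff (subset_refl _) hF₁G)
        refine h8.trans (mul_le_mul_of_nonneg_right (le_trans ?_ hS₁C) hψ0.le)
        exact_mod_cast card_le_card (sdiff_subset_sdiff sdiff_subset (subset_refl _))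
      calc ∑ u ∈ S, ((up u \ F).card : ℝ)
          ≤ ∑ u ∈ S, (((up u ∩ (G \ F)).card : ℝ) + ((up u \ G).card : ℝ)) := sum_le_sum h3
        _ = _ := sum_add_distrib
        _ ≤ 12 * t * ψ := by linarith
    have h9 : 3 / (n : ℝ) * ∑ u ∈ S, ((up u \ F).card : ℝ) ≤ t / (24 * l) := by
      calc 3 / (n : ℝ) * ∑ u ∈ S, ((up u \ F).card : ℝ) ≤ 3 / n * (12 * t * ψ) := by gcongr
        _ = t / (24 * l) := by rw [hψ]; field_simp; ring
    linarith

end IsLevel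

end GraphContainer

/-! ### Counting sets with given approximations. -/

namespace GraphContainer

open Finset

section Counting

variable {V : Type*} [DecidableEq V] {up : V → Finset V} {X : Finset V} {n : ℕ}

/-- One term of the binomial expansion of `(1 / x + 1) ^ N`, which is at most `exp (N / x)`. -/
lemma choose_le_pow_mul_exp {x : ℝ} (hx : 0 < x) (N q : ℕ) :
    (N.choose q : ℝ) ≤ x ^ q * Real.exp (N / x) := by
  rcases lt_or_ge N q with hlt | hle
  · rw [Nat.choose_eq_zero_of_lt hlt, Nat.cast_zero]; positivity
  have h1 : (1 / x) ^ q * (N.choose q : ℝ) ≤ (1 / x + 1) ^ N := by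
    rw [add_pow]
    have := single_le_sum (s := range (N + 1))
      (f := fun m => (1 / x) ^ m * 1 ^ (N - m) * (N.choose m : ℝ))
      (fun m _ => by positivity) (mem_range.2 (Nat.lt_succ_of_le hle))
    simpa using this
  have h2 : (1 / x + 1) ^ N ≤ Real.exp (N / x) := by
    calc (1 / x + 1) ^ N ≤ Real.exp (1 / x) ^ N :=
          pow_le_pow_left₀ (by positivity) (Real.add_one_le_exp _) N
      _ = Real.exp (N / x) := by rw [← Real.exp_nat_mul]; congr 1; ring
  calc (N.choose q : ℝ) = x ^ q * ((1 / x) ^ q * (N.choose q : ℝ)) := by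
        rw [← mul_assoc, ← mul_pow]; field_simp; simp
    _ ≤ x ^ q * Real.exp (N / x) := by gcongr; exact h1.trans h2

/-- The vertices of `X` whose upper neighbours all lie in `N(A)`. -/
def closure (up : V → Finset V) (X A : Finset V) : Finset V :=
  X.filter fun v => up v ⊆ A.biUnion up

lemma subset_closure {A : Finset V} (hA : A ⊆ X) : A ⊆ closure up X A := fun _ hx =>
  mem_filter.2 ⟨hA hx, subset_biUnion_of_mem up hx⟩

lemma biUnion_closure {A : Finset V} (hA : A ⊆ X) :
    (closure up X A).biUnion up = A.biUnion up :=
  (biUnion_subset.2 fun _ hx => (mem_filter.1 hx).2).antisymm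
    (biUnion_subset_biUnion_of_subset_left _ (subset_closure hA))

lemma card_Icc_le_rpow (H S : Finset V) {r : ℝ} (hr : (S.card : ℝ) - H.card ≤ r) :
    ((Icc H S).card : ℝ) ≤ (2 : ℝ) ^ r := by
  by_cases hHS : H ⊆ S
  · rw [card_Icc_finset hHS, Nat.cast_pow, Nat.cast_ofNat, ← Real.rpow_natCast,
      Nat.cast_sub (card_le_card hHS)]
    exact Real.rpow_le_rpow_of_exponent_le (by norm_num) hr
  · rw [Icc_eq_empty (by simpa using hHS)]
    simp only [card_empty, Nat.cast_zero]
    positivity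

/-- The number of sets with prescribed approximations and prescribed sizes that contain `H`. -/
lemma card_approximated_le (hX : ∀ x ∈ X, (up x).card ≤ n) {F S H : Finset V} (hS : S ⊆ X)
    {a g : ℕ} (hag : a ≤ g) {κ l : ℝ} (hn : 16 * κ ≤ n) (hn2 : 2 ≤ n)
    (hl : l = Real.logb 2 n) (hgt : (g : ℝ) ≤ κ * n * ((g : ℝ) - a))
    (hSF : (S.card : ℝ) ≤ F.card + ((g : ℝ) - a) / (24 * l)) (𝒜 : Finset (Finset V))
    (h𝒜 : ∀ A ∈ 𝒜, A ⊆ X ∧ H ⊆ A ∧ (closure up X A).card = a ∧ (A.biUnion up).card = g ∧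
      F ⊆ A.biUnion up ∧ closure up X A ⊆ S) :
    (𝒜.card : ℝ) ≤ (2 : ℝ) ^ ((g : ℝ) - H.card - ((g : ℝ) - a) / (24 * l)) := by
  have hn' : (2 : ℝ) ≤ n := by exact_mod_cast hn2
  have hl1 : 1 ≤ l := by
    rw [hl, Real.le_logb_iff_rpow_le (by norm_num) (by linarith)]
    simpa using hn'
  have hnl : (2 : ℝ) ^ l = n := by
    rw [hl]; exact Real.rpow_logb (by norm_num) (by norm_num) (by linarith)
  generalize ht : (g : ℝ) - a = t at *
  have ht0 : 0 ≤ t := by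
    have : (a : ℝ) ≤ g := by exact_mod_cast hag
    linarith
  have htl : t / (24 * l) ≤ t / 24 := by gcongr; linarith
  -- If `S` is this small, choosing `A` between `H` and `S` already gives the bound. Otherwise `F`
  -- misses at most `t / (12 * l)` points of `N(A)`.
  rcases le_or_gt (S.card : ℝ) (g - t / (24 * l)) with hloose | htight
  · refine le_trans ?_ (card_Icc_le_rpow H S (by linarith))
    refine Nat.cast_le.2 (card_le_card fun A hA => ?_)
    obtain ⟨h1, h2, -, -, -, h3⟩ := h𝒜 A hA
    exact mem_Icc.2 ⟨h2, (subset_closure h1).trans h3⟩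
  rcases 𝒜.eq_empty_or_nonempty with rfl | ⟨A₀, hA₀⟩
  · simp only [card_empty, Nat.cast_zero]; positivity
  obtain ⟨-, -, -, hg₀, hF₀, -⟩ := h𝒜 A₀ hA₀
  have hFg : F.card ≤ g := hg₀ ▸ card_le_card hF₀
  have hFg' : (F.card : ℝ) ≤ g := by exact_mod_cast hFg
  set q := g - F.card with hq
  have hq' : (q : ℝ) = g - F.card := by rw [hq, Nat.cast_sub hFg]
  have hqt : (q : ℝ) ≤ t / (12 * l) := by
    have : t / (12 * l) = t / (24 * l) + t / (24 * l) := by field_simp; ring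
    linarith
  set N := (S.biUnion up).card with hN
  have hNn : (N : ℝ) ≤ 2 * κ * n ^ 2 * t := by
    have h1 : N ≤ S.card * n := card_biUnion_le_card_mul _ _ _ fun x hx => hX x (hS hx)
    have h2 : (N : ℝ) ≤ S.card * n := by exact_mod_cast h1
    have h3 : t ≤ g := by
      have : (0 : ℝ) ≤ a := by positivity
      linarith
    have h4 : (S.card : ℝ) ≤ 2 * g := by linarith
    calc (N : ℝ) ≤ (2 * (κ * n * t)) * n := by
          refine h2.trans ?_
          gcongr
          linarith
      _ = _ := by ring
  -- The missing part of `N(A)` determines `N(A)` and hence the closure, which has `a` elements and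
  -- contains `A`.
  have hcount : 𝒜.card ≤ ⌊(2 : ℝ) ^ ((a : ℝ) - H.card)⌋₊ * N.choose q := by
    rw [hN, ← card_powersetCard]
    refine card_le_mul_card_image_of_maps_to (f := fun A => A.biUnion up \ F) ?_ _ ?_
    · intro A hA
      obtain ⟨h1, -, -, h2, h3, h4⟩ := h𝒜 A hA
      rw [mem_powersetCard]
      refine ⟨sdiff_subset.trans (biUnion_subset_biUnion_of_subset_left _
        ((subset_closure h1).trans h4)), ?_⟩
      rw [card_sdiff_of_subset h3, h2]
    · intro Q _
      rcases (𝒜.filter fun A => A.biUnion up \ F = Q).eq_empty_or_nonempty with he | ⟨A₁, hA₁⟩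
      · rw [he]; simp
      rw [mem_filter] at hA₁
      obtain ⟨-, -, ha₁, -, hF₁, -⟩ := h𝒜 A₁ hA₁.1
      refine Nat.le_floor (le_trans ?_ (card_Icc_le_rpow H (closure up X A₁) (by rw [ha₁])))
      refine Nat.cast_le.2 (card_le_card fun A hA => ?_)
      rw [mem_filter] at hA
      obtain ⟨h1, h2, -, -, h3, -⟩ := h𝒜 A hA.1
      have h4 : A.biUnion up = A₁.biUnion up := by
        rw [← sdiff_union_of_subset h3, ← sdiff_union_of_subset hF₁, hA.2, hA₁.2]
      refine mem_Icc.2 ⟨h2, ?_⟩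
      have h5 : closure up X A₁ = closure up X A := by rw [closure, closure, h4]
      rw [h5]
      exact subset_closure h1
  have hchoose : (N.choose q : ℝ) ≤ (2 : ℝ) ^ (t / 2) := by
    -- With `x = n ^ 3 = 2 ^ (3 * l)` the power costs `2 ^ (t / 4)`, while `N / x ≤ t / 8` keeps the
    -- exponential below `2 ^ (t / 4)`.
    refine (choose_le_pow_mul_exp (x := (n : ℝ) ^ 3) (by positivity) N q).trans ?_
    have h1 : ((n : ℝ) ^ 3) ^ q ≤ (2 : ℝ) ^ (t / 4) := by
      rw [← pow_mul, ← Real.rpow_natCast, ← hnl, ← Real.rpow_mul (by norm_num)]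
      refine Real.rpow_le_rpow_of_exponent_le (by norm_num) ?_
      push_cast
      calc l * (3 * (q : ℝ)) ≤ l * (3 * (t / (12 * l))) := by gcongr
        _ = t / 4 := by field_simp; ring
    have h2 : Real.exp ((N : ℝ) / (n : ℝ) ^ 3) ≤ (2 : ℝ) ^ (t / 4) := by
      rw [Real.rpow_def_of_pos (by norm_num)]
      refine Real.exp_le_exp.2 ?_
      have h3 : (N : ℝ) / (n : ℝ) ^ 3 ≤ t / 8 := by
        rw [div_le_iff₀ (by positivity)]
        calc (N : ℝ) ≤ 2 * κ * n ^ 2 * t := hNn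
          _ = (16 * κ) * (n ^ 2 * t / 8) := by ring
          _ ≤ n * (n ^ 2 * t / 8) := by gcongr
          _ = _ := by ring
      nlinarith [Real.log_two_gt_d9]
    calc ((n : ℝ) ^ 3) ^ q * Real.exp ((N : ℝ) / (n : ℝ) ^ 3)
        ≤ (2 : ℝ) ^ (t / 4) * (2 : ℝ) ^ (t / 4) := by gcongr
      _ = _ := by rw [← Real.rpow_add (by norm_num)]; congr 1; ring
  calc (𝒜.card : ℝ) ≤ ⌊(2 : ℝ) ^ ((a : ℝ) - H.card)⌋₊ * N.choose q := by exact_mod_cast hcount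
    _ ≤ (2 : ℝ) ^ ((a : ℝ) - H.card) * (2 : ℝ) ^ (t / 2) := by
        gcongr
        exact Nat.floor_le (by positivity)
    _ = (2 : ℝ) ^ ((a : ℝ) - H.card + t / 2) := by rw [← Real.rpow_add (by norm_num)]
    _ ≤ _ := Real.rpow_le_rpow_of_exponent_le (by norm_num) (by linarith)

end Counting

/-! ### Counting linked sets by walks. -/

section Linked

variable {V : Type*} [DecidableEq V]

/-- Every proper nonempty part of `Z` is related to some point of the remainder. -/
def LinkedBy (R : V → V → Prop) (Z : Finset V) : Prop :=
  ∀ S ⊆ Z, S.Nonempty → S ≠ Z → ∃ s ∈ S, ∃ z ∈ Z, z ∉ S ∧ R s z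

lemma LinkedBy.exists_walk {R : V → V → Prop} (hR : ∀ x y, R x y → R y x) {Z : Finset V}
    (hZ : LinkedBy R Z) (m : ℕ) (hm : m + 1 ≤ Z.card) :
    ∃ l : List V, l.IsChain R ∧ l.toFinset ⊆ Z ∧ l.toFinset.card = m + 1 ∧
      l.length = 2 * m + 1 := by
  induction m with
  | zero =>
    obtain ⟨z, hz⟩ := card_pos.1 (by omega : 0 < Z.card)
    exact ⟨[z], by simp, by simpa using hz, by simp, by simp⟩
  | succ m ih =>
    obtain ⟨l, hl, hlZ, hlc, hll⟩ := ih (by omega)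
    obtain ⟨s, hs, z, hz, hzl, hsz⟩ := hZ l.toFinset hlZ (card_pos.1 (by omega))
      (fun he => by rw [he] at hlc; omega)
    rw [List.mem_toFinset] at hs hzl
    obtain ⟨l₁, l₂, rfl⟩ := List.append_of_mem hs
    -- A detour from `s` to the new point `z` and back lengthens the walk by two.
    refine ⟨l₁ ++ s :: z :: s :: l₂, ?_, ?_, ?_, ?_⟩
    · rw [List.isChain_append] at hl ⊢
      refine ⟨hl.1, ?_, by simpa using hl.2.2⟩
      exact List.isChain_cons_cons.2 ⟨hsz, List.isChain_cons_cons.2 ⟨hR _ _ hsz, hl.2.1⟩⟩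
    · intro w hw
      simp only [List.mem_toFinset, List.mem_append, List.mem_cons] at hw
      rcases hw with hw | rfl | rfl | rfl | hw
      · exact hlZ (by simp [hw])
      · exact hlZ (by simp)
      · exact hz
      · exact hlZ (by simp)
      · exact hlZ (by simp [hw])
    · have h1 : (l₁ ++ s :: z :: s :: l₂).toFinset = insert z (l₁ ++ s :: l₂).toFinset := by
        ext w; simp only [List.mem_toFinset, List.mem_append, List.mem_cons, mem_insert]; tauto
      rw [h1, card_insert_of_notMem (by rwa [List.mem_toFinset]), hlc]
    · simp only [List.length_append, List.length_cons] at hll ⊢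
      omega

/-- Stuttering at the first point pads the walk to a prescribed length, so linked sets of different
sizes are encoded by walks of one length. -/
lemma LinkedBy.exists_covering_walk {R : V → V → Prop} (hR : ∀ x y, R x y → R y x)
    (hrefl : ∀ x, R x x) {Z : Finset V} (hZ : LinkedBy R Z) (hne : Z.Nonempty) {k : ℕ}
    (hk : 2 * Z.card ≤ k + 1) :
    ∃ l : List V, l.IsChain R ∧ l.toFinset = Z ∧ l.length = k + 1 := by
  have hpos := hne.card_pos
  obtain ⟨j, rfl⟩ : ∃ j, k = 2 * (Z.card - 1) + j := ⟨k - 2 * (Z.card - 1), by omega⟩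
  clear hk
  induction j with
  | zero =>
    obtain ⟨l, h1, h2, h3, h4⟩ := hZ.exists_walk hR (Z.card - 1) (by omega)
    exact ⟨l, h1, eq_of_subset_of_card_le h2 (by omega), h4⟩
  | succ j ih =>
    obtain ⟨l, h1, h2, h3⟩ := ih
    match l, h1, h2, h3 with
    | v :: l, h1, h2, h3 =>
      refine ⟨v :: v :: l, List.isChain_cons_cons.2 ⟨hrefl v, h1⟩, ?_, ?_⟩
      · rw [← h2]; simp
      · simp only [List.length_cons] at h3 ⊢; omega

/-- The walks with `k` steps from `v`, a step going from `w` to a point of `ball w`. -/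
def walksFrom (ball : V → Finset V) : ℕ → V → Finset (List V)
  | 0, v => {[v]}
  | k + 1, v => (ball v).biUnion fun w => (walksFrom ball k w).image (v :: ·)

lemma card_walksFrom_le {ball : V → Finset V} {D : ℕ} (hD : ∀ v, (ball v).card ≤ D) (k : ℕ)
    (v : V) : (walksFrom ball k v).card ≤ D ^ k := by
  induction k generalizing v with
  | zero => simp [walksFrom]
  | succ k ih =>
    rw [walksFrom, pow_succ, mul_comm]
    refine (card_biUnion_le_card_mul _ _ (D ^ k) fun w _ => card_image_le.trans (ih w)).trans ?_
    exact Nat.mul_le_mul_right _ (hD v)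

lemma mem_walksFrom {R : V → V → Prop} {ball : V → Finset V} (hR : ∀ v w, R v w → w ∈ ball v)
    (k : ℕ) (v : V) (l : List V) (hl : (v :: l).IsChain R) (hk : l.length = k) :
    v :: l ∈ walksFrom ball k v := by
  induction k generalizing v l with
  | zero => rw [List.length_eq_zero_iff] at hk; simp [walksFrom, hk]
  | succ k ih =>
    match l, hl, hk with
    | w :: l, hl, hk =>
      rw [List.isChain_cons_cons] at hl
      exact mem_biUnion.2 ⟨w, hR v w hl.1, mem_image_of_mem _ (ih w l hl.2 (by simpa using hk))⟩

/-- The number of tuples of sets whose union is linked and has at most `M` elements. -/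
lemma card_linked_tuples_le [Fintype V] {ι : Type*} [Fintype ι] [DecidableEq ι]
    {R : V → V → Prop} (hR : ∀ x y, R x y → R y x) (hrefl : ∀ x, R x x) {ball : V → Finset V}
    (hball : ∀ v w, R v w → w ∈ ball v) {D : ℕ} (hD : ∀ v, (ball v).card ≤ D) (M : ℕ)
    (𝒯 : Finset (ι → Finset V))
    (h𝒯 : ∀ P ∈ 𝒯, (univ.biUnion P).Nonempty ∧ (univ.biUnion P).card ≤ M ∧
      LinkedBy R (univ.biUnion P)) :
    𝒯.card ≤ Fintype.card V * D ^ (2 * M) * 2 ^ (Fintype.card ι * M) := by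
  set 𝒵 : Finset (Finset V) :=
    univ.biUnion fun v => (walksFrom ball (2 * M) v).image List.toFinset with h𝒵
  have h1 : 𝒵.card ≤ Fintype.card V * D ^ (2 * M) := by
    rw [← card_univ]
    exact card_biUnion_le_card_mul _ _ _ fun v _ => card_image_le.trans (card_walksFrom_le hD _ v)
  rw [mul_comm]
  refine (card_le_mul_card_image_of_maps_to (f := fun P => univ.biUnion P) (t := 𝒵) ?_
    (2 ^ (Fintype.card ι * M)) ?_).trans (Nat.mul_le_mul_left _ h1)
  · intro P hP
    obtain ⟨hne, hM, hlink⟩ := h𝒯 P hP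
    obtain ⟨l, hl, hlZ, hlk⟩ := hlink.exists_covering_walk hR hrefl hne (k := 2 * M) (by omega)
    match l, hl, hlZ, hlk with
    | v :: l, hl, hlZ, hlk =>
      exact mem_biUnion.2 ⟨v, mem_univ _, mem_image.2
        ⟨v :: l, mem_walksFrom hball _ v l hl (by simpa using hlk), hlZ⟩⟩
  · intro Z _
    rcases (𝒯.filter fun P => univ.biUnion P = Z).eq_empty_or_nonempty with he | ⟨P₀, hP₀⟩
    · rw [he]; simp
    have hZM : Z.card ≤ M := by
      rw [mem_filter] at hP₀
      rw [← hP₀.2]; exact (h𝒯 P₀ hP₀.1).2.1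
    have h2 : (𝒯.filter fun P => univ.biUnion P = Z) ⊆
        Fintype.piFinset fun _ : ι => Z.powerset := by
      intro P hP
      rw [mem_filter] at hP
      rw [Fintype.mem_piFinset]
      intro i
      rw [mem_powerset, ← hP.2]
      exact subset_biUnion_of_mem P (mem_univ i)
    refine (card_le_card h2).trans ?_
    rw [Fintype.card_piFinset, prod_const, card_powerset, card_univ, ← pow_mul, mul_comm]
    exact Nat.pow_le_pow_right (by norm_num) (Nat.mul_le_mul_left _ hZM)

end Linked

end GraphContainer

/-! ### Degrees in the grid. -/

namespace ThreeGrid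

open Finset

variable {n : ℕ}

/-- The number of coordinates of `v` equal to `a`. -/
def countOf (a : Fin 3) (v : Grid n) : ℕ := (univ.filter fun i => v i = a).card

/-- The points covered by `w`. -/
noncomputable def downNbhd (w : Grid n) : Finset (Grid n) :=
  open Classical in univ.filter fun v => w ∈ upNbhd v

lemma covBy_iff {v w : Grid n} :
    v ⋖ w ↔ ∃ i, (w i : ℕ) = v i + 1 ∧ ∀ j, j ≠ i → w j = v j := by
  rw [Pi.covBy_iff]
  refine exists_congr fun i => and_congr ?_ (forall_congr' fun j => imp_congr_right fun _ => eq_comm)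
  rw [Fin.covBy_iff, Nat.covBy_iff_add_one_eq, eq_comm]

lemma sum_of_covBy {v w : Grid n} (h : v ⋖ w) : ∑ i, (w i : ℕ) = ∑ i, (v i : ℕ) + 1 := by
  obtain ⟨i, hi, hj⟩ := covBy_iff.1 h
  rw [← add_sum_erase univ _ (mem_univ i), ← add_sum_erase univ (fun i => (v i : ℕ)) (mem_univ i),
    hi, sum_congr rfl fun j hj' => by rw [hj j (ne_of_mem_erase hj')]]
  ring

lemma mem_upNbhd {v w : Grid n} : w ∈ upNbhd v ↔ v ⋖ w := by
  simp only [upNbhd, layer, mem_filter, mem_univ, true_and, SimpleGraph.hasse_adj]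
  constructor
  · rintro ⟨h1, h2 | h2⟩
    · exact h2
    · have := sum_of_covBy h2; omega
  · exact fun h => ⟨sum_of_covBy h, Or.inl h⟩

lemma mem_downNbhd {v w : Grid n} : v ∈ downNbhd w ↔ v ⋖ w := by
  simp [downNbhd, mem_upNbhd]

lemma mem_layer {k : ℕ} {v : Grid n} : v ∈ layer n k ↔ ∑ i, (v i : ℕ) = k := by
  simp [layer]

lemma countOf_add (v : Grid n) : countOf 0 v + countOf 1 v + countOf 2 v = n := by
  have h : ∑ i, ((if v i = 0 then 1 else 0) + (if v i = 1 then 1 else 0) +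
      (if v i = 2 then 1 else 0)) = ∑ _i : Fin n, 1 := by
    refine sum_congr rfl fun i _ => ?_
    generalize v i = a
    revert a; decide
  simp only [sum_add_distrib, ← card_filter, sum_const, card_univ, Fintype.card_fin, smul_eq_mul,
    mul_one] at h
  exact h

lemma sum_add_countOf_zero (v : Grid n) : ∑ i, (v i : ℕ) + countOf 0 v = n + countOf 2 v := by
  have h : ∑ i, ((v i : ℕ) + (if v i = 0 then 1 else 0)) =
      ∑ i : Fin n, (1 + (if v i = 2 then 1 else 0)) := by
    refine sum_congr rfl fun i _ => ?_
    generalize v i = a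
    revert a; decide
  simp only [sum_add_distrib, ← card_filter, sum_const, card_univ, Fintype.card_fin, smul_eq_mul,
    mul_one] at h
  exact h

/-- Lower the `i`-th coordinate by one. -/
def lower (w : Grid n) (i : Fin n) : Grid n := Function.update w i (w i - 1)

/-- Raise the `i`-th coordinate by one. -/
def raise (v : Grid n) (i : Fin n) : Grid n := Function.update v i (v i + 1)

lemma val_sub_one {a : Fin 3} (h : a ≠ 0) : (a : ℕ) = ((a - 1 : Fin 3) : ℕ) + 1 := by
  revert a; decide

lemma val_add_one {a : Fin 3} (h : a ≠ 2) : ((a + 1 : Fin 3) : ℕ) = (a : ℕ) + 1 := by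
  revert a; decide

lemma downNbhd_eq_image (w : Grid n) :
    downNbhd w = (univ.filter fun i => w i ≠ 0).image (lower w) := by
  ext v
  simp only [mem_downNbhd, covBy_iff, mem_image, mem_filter, mem_univ, true_and]
  constructor
  · rintro ⟨i, hi, hj⟩
    have h0 : w i ≠ 0 := by intro h; rw [h] at hi; simp at hi
    refine ⟨i, h0, funext fun j => ?_⟩
    by_cases hji : j = i
    · subst hji
      have := val_sub_one h0
      rw [lower, Function.update_self]
      exact Fin.ext (by omega)
    · rw [lower, Function.update_of_ne hji, hj j hji]
  · rintro ⟨i, h0, rfl⟩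
    refine ⟨i, ?_, fun j hj => ?_⟩
    · rw [lower, Function.update_self]; exact val_sub_one h0
    · rw [lower, Function.update_of_ne hj]

lemma lower_injOn (w : Grid n) : Set.InjOn (lower w) (univ.filter fun i => w i ≠ 0) := by
  intro i hi j _ hij
  have hi0 : w i ≠ 0 := (mem_filter.1 hi).2
  by_contra hne
  have h1 := congrFun hij i
  rw [lower, lower, Function.update_self, Function.update_of_ne hne] at h1
  have := val_sub_one hi0
  rw [h1] at this
  omega

lemma upNbhd_eq_image (v : Grid n) :
    upNbhd v = (univ.filter fun i => v i ≠ 2).image (raise v) := by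
  ext w
  simp only [mem_upNbhd, covBy_iff, mem_image, mem_filter, mem_univ, true_and]
  constructor
  · rintro ⟨i, hi, hj⟩
    have h0 : v i ≠ 2 := by
      intro h
      have := (w i).isLt
      rw [h] at hi
      simp at hi
      omega
    refine ⟨i, h0, funext fun j => ?_⟩
    by_cases hji : j = i
    · subst hji
      have := val_add_one h0
      rw [raise, Function.update_self]
      exact Fin.ext (by omega)
    · rw [raise, Function.update_of_ne hji, hj j hji]
  · rintro ⟨i, h0, rfl⟩
    refine ⟨i, ?_, fun j hj => ?_⟩
    · rw [raise, Function.update_self]; exact val_add_one h0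
    · rw [raise, Function.update_of_ne hj]

lemma raise_injOn (v : Grid n) : Set.InjOn (raise v) (univ.filter fun i => v i ≠ 2) := by
  intro i hi j _ hij
  have hi0 : v i ≠ 2 := (mem_filter.1 hi).2
  by_contra hne
  have h1 := congrFun hij i
  rw [raise, raise, Function.update_self, Function.update_of_ne hne] at h1
  have := val_add_one hi0
  rw [h1] at this
  omega

lemma card_upNbhd (v : Grid n) : (upNbhd v).card + countOf 2 v = n := by
  rw [upNbhd_eq_image, card_image_of_injOn (raise_injOn v), countOf, add_comm]
  have := card_filter_add_card_filter_not (s := (univ : Finset (Fin n))) (fun i => v i = 2)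
  simpa using this

lemma card_downNbhd (w : Grid n) : (downNbhd w).card + countOf 0 w = n := by
  rw [downNbhd_eq_image, card_image_of_injOn (lower_injOn w), countOf, add_comm]
  have := card_filter_add_card_filter_not (s := (univ : Finset (Fin n))) (fun i => w i = 0)
  simpa using this

lemma countOf_two_le {v w : Grid n} (h : v ≤ w) : countOf 2 v ≤ countOf 2 w := by
  refine card_le_card fun i hi => ?_
  rw [mem_filter] at hi ⊢
  refine ⟨mem_univ i, le_antisymm (Fin.le_last _) ?_⟩
  have := h i
  rw [hi.2] at this
  exact this

/-- A common upper cover of two distinct points of any kind can only be their join. -/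
lemma card_upNbhd_inter_le {x x' : Grid n} (hne : x ≠ x') :
    (upNbhd x ∩ upNbhd x').card ≤ 1 := by
  have key : ∀ y ∈ upNbhd x ∩ upNbhd x', y = x ⊔ x' := by
    intro y hy
    rw [mem_inter, mem_upNbhd, mem_upNbhd] at hy
    have h1 : ¬ x' ≤ x := by
      intro hle
      exact hne (hle.eq_or_lt.resolve_right fun hlt => hy.2.2 hlt hy.1.1).symm
    have h2 : x < x ⊔ x' := left_lt_sup.2 h1
    exact ((sup_le hy.1.le hy.2.le).eq_or_lt.resolve_right fun hlt => hy.1.2 h2 hlt).symm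
  rw [card_le_one]
  intro y hy y' hy'
  rw [key y hy, key y' hy']

/-- In `L_k` the number of zeros minus the number of twos is `n - k`. Up-degrees count the non-twos
and down-degrees the non-zeros, so all degree conditions follow from this balance. -/
lemma isLevel_layer {k : ℕ} (hn : 3 ≤ n) (hk : k < n) (hk2 : n ≤ k + 2) :
    GraphContainer.IsLevel (upNbhd (n := n)) downNbhd (layer n k) n := by
  have hlow : ∀ x ∈ layer n k, k + countOf 0 x = n + countOf 2 x := fun x hx => by
    have := sum_add_countOf_zero x
    rwa [mem_layer.1 hx] at this
  have hhigh : ∀ x ∈ layer n k, ∀ y ∈ upNbhd x, k + 1 + countOf 0 y = n + countOf 2 y :=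
    fun x hx y hy => by
      have := sum_add_countOf_zero y
      rwa [sum_of_covBy (mem_upNbhd.1 hy), mem_layer.1 hx] at this
  refine ⟨fun x y => by rw [mem_upNbhd, mem_downNbhd], ?_, ?_, ?_, ?_, ?_, ?_⟩
  · intro x hx y hy z hz
    rw [mem_layer] at hx ⊢
    have h1 := sum_of_covBy (mem_upNbhd.1 hy)
    have h2 := sum_of_covBy (mem_downNbhd.1 hz)
    omega
  · intro x _
    have := card_upNbhd x
    omega
  · intro x hx
    have h1 := card_upNbhd x
    have h2 := hlow x hx
    have h3 := countOf_add x
    omega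
  · intro x hx y hy
    have h1 := card_downNbhd y
    have h2 := hhigh x hx y hy
    have h3 := countOf_add y
    omega
  · intro x hx y hy
    have h1 := card_downNbhd y
    have h2 := hhigh x hx y hy
    have h3 := card_upNbhd x
    have h4 := countOf_two_le (mem_upNbhd.1 hy).le
    omega
  · exact fun x _ x' _ hne => card_upNbhd_inter_le hne

open GraphContainer

/-! ### Vacancies in the grid. -/

/-- Below the layer `n - 1` every vertex of the neighbourhood leaves a vacancy of at least `1 / n`. -/
lemma card_nbhd_le_of_layer_sub_two {k : ℕ} (hn : 3 ≤ n) (hk : k + 2 = n) {C : Finset (Grid n)}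
    (hC : C ⊆ layer n k) :
    ((C.biUnion upNbhd).card : ℝ) ≤ n * (((C.biUnion upNbhd).card : ℝ) - C.card) := by
  have hlev := isLevel_layer (n := n) (k := k) hn (by omega) (by omega)
  have hn' : (0 : ℝ) < n := by exact_mod_cast (by omega : 0 < n)
  have h1 := hlev.sum_deficit_le (by omega) hC
  have h2 : ((C.biUnion upNbhd).card : ℝ) * (1 / n) ≤
      ∑ y ∈ C.biUnion upNbhd, (1 - ∑ x ∈ downNbhd y, share upNbhd x) := by
    rw [← nsmul_eq_mul]
    refine card_nsmul_le_sum _ _ _ fun y hy => ?_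
    obtain ⟨x₀, hx₀, hxy⟩ := mem_biUnion.1 hy
    have hy' : k + 1 + countOf 0 y = n + countOf 2 y := by
      have := sum_add_countOf_zero y
      rwa [sum_of_covBy (mem_upNbhd.1 hxy), mem_layer.1 (hC hx₀)] at this
    have hd := card_downNbhd y
    set d := (downNbhd y).card with hdd
    -- A point `y` of `L_{n-1}` has one more zero than twos, so its lower neighbours have up-degree
    -- at least `d + 1`.
    have h3 : ∑ x ∈ downNbhd y, share upNbhd x ≤ d * (1 / ((d : ℝ) + 1)) := by
      rw [hdd, ← nsmul_eq_mul]
      refine sum_le_card_nsmul _ _ _ fun x hx => ?_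
      have h4 := countOf_two_le (mem_downNbhd.1 hx).le
      have h5 := card_upNbhd x
      have h6 : d + 1 ≤ (upNbhd x).card := by omega
      have h7 : (d : ℝ) + 1 ≤ (upNbhd x).card := by exact_mod_cast h6
      exact one_div_le_one_div_of_le (by positivity) h7
    have h8 : (d : ℝ) * (1 / ((d : ℝ) + 1)) = 1 - 1 / ((d : ℝ) + 1) := by field_simp; ring
    have h9 : 1 / (n : ℝ) ≤ 1 / ((d : ℝ) + 1) := by
      refine one_div_le_one_div_of_le (by positivity) ?_
      have : d + 1 ≤ n := by omega
      exact_mod_cast this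
    linarith
  have h3 := h2.trans h1
  rw [mul_one_div, div_le_iff₀ hn'] at h3
  linarith

lemma countOf_lower_of_eq_one {w : Grid n} {i : Fin n} (h : w i = 1) :
    countOf 2 (lower w i) = countOf 2 w := by
  unfold countOf
  congr 1
  ext j
  simp only [mem_filter, mem_univ, true_and]
  by_cases hj : j = i
  · subst hj; rw [lower, Function.update_self, h]; decide
  · rw [lower, Function.update_of_ne hj]

lemma countOf_lower_of_eq_two {w : Grid n} {i : Fin n} (h : w i = 2) :
    countOf 2 (lower w i) + 1 = countOf 2 w := by
  unfold countOf
  rw [← card_erase_add_one (s := univ.filter fun j => w j = 2) (a := i) (by simp [h])]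
  congr 2
  ext j
  simp only [mem_filter, mem_univ, true_and, mem_erase]
  by_cases hj : j = i
  · subst hj; rw [lower, Function.update_self, h]; simp
  · rw [lower, Function.update_of_ne hj]; simp [hj]

/-- The vacancy of a point of the layer `n` with `j` twos. -/
lemma le_one_sub_sum_share (hn : 1 ≤ n) {y : Grid n} (hy : ∑ i, (y i : ℕ) = n) :
    (countOf 2 y : ℝ) / (n * (n + 1)) ≤ 1 - ∑ x ∈ downNbhd y, share upNbhd x := by
  have h0 := sum_add_countOf_zero y
  have h1 := countOf_add y
  rw [hy] at h0
  set j := countOf 2 y with hj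
  have hjn : 2 * j ≤ n := by omega
  have hjn' : 2 * (j : ℝ) ≤ n := by exact_mod_cast hjn
  have hn' : (1 : ℝ) ≤ n := by exact_mod_cast hn
  have hone : (countOf 1 y : ℝ) = n - 2 * j := by
    have : countOf 1 y + 2 * j = n := by omega
    have h2 : (countOf 1 y : ℝ) + 2 * j = n := by exact_mod_cast this
    linarith
  -- Lowering a `1` keeps `j` twos and gives up-degree `n - j`; lowering a `2` gives `n - j + 1`.
  have hsum : ∑ x ∈ downNbhd y, share upNbhd x =
      countOf 1 y * (1 / ((n : ℝ) - j)) + j * (1 / ((n : ℝ) - j + 1)) := by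
    rw [downNbhd_eq_image, sum_image (lower_injOn y)]
    have hsplit : (univ.filter fun i => y i ≠ 0) =
        (univ.filter fun i => y i = 1) ∪ univ.filter fun i => y i = 2 := by
      ext i
      simp only [mem_filter, mem_univ, true_and, mem_union]
      generalize y i = a
      revert a; decide
    have hdisj : Disjoint (univ.filter fun i => y i = 1) (univ.filter fun i => y i = 2) := by
      rw [disjoint_filter]
      intro i _ h h'
      rw [h] at h'
      exact absurd h' (by decide)
    rw [hsplit, sum_union hdisj]
    congr 1
    · rw [sum_congr rfl (g := fun _ => 1 / ((n : ℝ) - j))]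
      · rw [sum_const, nsmul_eq_mul, countOf]
      · intro i hi
        have h2 := card_upNbhd (lower y i)
        rw [countOf_lower_of_eq_one (mem_filter.1 hi).2, ← hj] at h2
        have h3 : ((upNbhd (lower y i)).card : ℝ) + j = n := by exact_mod_cast h2
        rw [share]
        congr 1
        linarith
    · rw [sum_congr rfl (g := fun _ => 1 / ((n : ℝ) - j + 1))]
      · rw [sum_const, nsmul_eq_mul, hj, countOf]
      · intro i hi
        have h2 := card_upNbhd (lower y i)
        have h3 := countOf_lower_of_eq_two (mem_filter.1 hi).2
        rw [← hj] at h3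
        have h4 : (upNbhd (lower y i)).card + j = n + 1 := by omega
        have h5 : ((upNbhd (lower y i)).card : ℝ) + j = n + 1 := by exact_mod_cast h4
        rw [share]
        congr 1
        linarith
  have hp : (0 : ℝ) < n - j := by
    have : (0 : ℝ) ≤ j := by positivity
    linarith
  have hp' : (0 : ℝ) < n - j + 1 := by linarith
  have hv : 1 - (((n : ℝ) - 2 * j) * (1 / ((n : ℝ) - j)) + j * (1 / ((n : ℝ) - j + 1))) =
      j / (((n : ℝ) - j) * (n - j + 1)) := by
    field_simp
    ring
  rw [hsum, hone, hv]
  have hj0 : (0 : ℝ) ≤ j := by positivity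
  gcongr <;> linarith

end ThreeGrid

/-! ### Edge and vertex isoperimetry. -/

namespace ThreeGrid

open Finset GraphContainer

variable {n : ℕ}

/-- For `x ≤ y` the factor `2 ^ m ≤ 2 ^ x` is absorbed by `2 * x ≤ x + y`. This is the induction
step of the edge-isoperimetric inequality. -/
lemma pow_self_mul_pow_self_mul_two_pow_le (x y m : ℕ) (hx : m ≤ x) (hy : m ≤ y) :
    x ^ x * y ^ y * 2 ^ m ≤ (x + y) ^ (x + y) := by
  wlog hxy : x ≤ y generalizing x y
  · rw [mul_comm (x ^ x), add_comm x]
    exact this y x hy hx (by omega)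
  calc x ^ x * y ^ y * 2 ^ m ≤ x ^ x * y ^ y * 2 ^ x := by gcongr; norm_num
    _ = (2 * x) ^ x * y ^ y := by rw [mul_pow]; ring
    _ ≤ (x + y) ^ x * (x + y) ^ y := by gcongr <;> omega
    _ = _ := by rw [pow_add]

/-- The number of covering pairs inside `S`. -/
noncomputable def edgeCount (S : Finset (Grid n)) : ℕ := ∑ x ∈ S, (upNbhd x ∩ S).card

lemma sum_card_upNbhd_inter (S F : Finset (Grid n)) :
    ∑ x ∈ S, (upNbhd x ∩ F).card = ∑ y ∈ F, (downNbhd y ∩ S).card := by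
  simp only [card_eq_sum_ones]
  refine sum_comm' fun u y => ?_
  simp only [mem_inter, mem_upNbhd, mem_downNbhd]
  tauto

/-- Together with its dual below, this says that the covering pairs crossing a cut in the `i`-th
coordinate form a matching. -/
lemma eq_of_covBy_of_apply_ne {x y y' : Grid n} (h : x ⋖ y) (h' : x ⋖ y') {i : Fin n}
    (hi : y i ≠ x i) (hi' : y' i ≠ x i) : y = y' := by
  obtain ⟨j, hj, hy⟩ := covBy_iff.1 h
  obtain ⟨j', hj', hy'⟩ := covBy_iff.1 h'
  have h1 : i = j := by by_contra hne; exact hi (hy i hne)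
  have h2 : i = j' := by by_contra hne; exact hi' (hy' i hne)
  subst h1 h2
  funext k
  by_cases hk : k = i
  · subst hk; exact Fin.ext (by omega)
  · rw [hy k hk, hy' k hk]

lemma eq_of_apply_ne_of_covBy {x x' y : Grid n} (h : x ⋖ y) (h' : x' ⋖ y) {i : Fin n}
    (hi : y i ≠ x i) (hi' : y i ≠ x' i) : x = x' := by
  obtain ⟨j, hj, hy⟩ := covBy_iff.1 h
  obtain ⟨j', hj', hy'⟩ := covBy_iff.1 h'
  have h1 : i = j := by by_contra hne; exact hi (hy i hne)
  have h2 : i = j' := by by_contra hne; exact hi' (hy' i hne)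
  subst h1 h2
  funext k
  by_cases hk : k = i
  · subst hk; exact Fin.ext (by omega)
  · rw [← hy k hk, ← hy' k hk]

/-- The edge-isoperimetric inequality in the grid. -/
lemma two_pow_edgeCount_le (S : Finset (Grid n)) : 2 ^ edgeCount S ≤ S.card ^ S.card := by
  induction S using Finset.strongInduction with
  | H S ih =>
    rcases le_or_gt S.card 1 with hS | hS
    · have h0 : edgeCount S = 0 := by
        refine sum_eq_zero fun x hx => ?_
        rw [card_eq_zero, ← not_nonempty_iff_eq_empty]
        rintro ⟨y, hy⟩
        rw [mem_inter, mem_upNbhd] at hy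
        exact hy.1.ne (card_le_one.1 hS x hx y hy.2)
      rw [h0, pow_zero]
      exact Nat.one_le_iff_ne_zero.2 (by rcases Nat.eq_zero_or_pos S.card with h | h <;> simp [h])
    obtain ⟨x, hx, x', hx', hne⟩ := one_lt_card.1 hS
    -- A threshold in a coordinate where two points differ splits `S` into two proper parts, and the
    -- crossing edges are at most as many as the points of the smaller part.
    obtain ⟨i, c, ⟨v, hv, hvc⟩, w, hw, hwc⟩ : ∃ i, ∃ c : Fin 3, (∃ v ∈ S, v i ≤ c) ∧ ∃ v ∈ S, ¬ v i ≤ c := by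
      obtain ⟨i, hi⟩ := Function.ne_iff.1 hne
      rcases lt_or_gt_of_ne hi with h | h
      · exact ⟨i, x i, ⟨x, hx, le_rfl⟩, x', hx', not_le.2 h⟩
      · exact ⟨i, x' i, ⟨x', hx', le_rfl⟩, x, hx, not_le.2 h⟩
    set lo := S.filter fun v => v i ≤ c with hlo
    set hi' := S.filter fun v => ¬ v i ≤ c with hhi
    have hdisj : Disjoint lo hi' := disjoint_filter_filter_not _ _ _
    have hunion : lo ∪ hi' = S := filter_union_filter_not_eq _ _
    have hcard : lo.card + hi'.card = S.card := by
      rw [← card_union_of_disjoint hdisj, hunion]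
    have hloS : lo ⊂ S := (filter_subset _ _).ssubset_of_ne fun he => by
      rw [← he, mem_filter] at hw; exact hwc hw.2
    have hhiS : hi' ⊂ S := (filter_subset _ _).ssubset_of_ne fun he => by
      rw [← he, mem_filter] at hv; exact hv.2 hvc
    set m := ∑ x ∈ lo, (upNbhd x ∩ hi').card with hm
    have hE : edgeCount S = edgeCount lo + edgeCount hi' + m := by
      have h1 : ∀ x ∈ lo, (upNbhd x ∩ S).card = (upNbhd x ∩ lo).card + (upNbhd x ∩ hi').card := by
        intro x _
        rw [← card_union_of_disjoint (hdisj.mono inter_subset_right inter_subset_right),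
          ← inter_union_distrib_left, hunion]
      have h2 : ∀ x ∈ hi', (upNbhd x ∩ S).card = (upNbhd x ∩ hi').card := by
        intro x hx
        congr 1
        refine (inter_subset_inter_left (filter_subset _ _)).antisymm' fun y hy => ?_
        rw [mem_inter, mem_upNbhd] at hy ⊢
        refine ⟨hy.1, mem_filter.2 ⟨hy.2, fun hle => ?_⟩⟩
        exact (mem_filter.1 hx).2 ((hy.1.le i).trans hle)
      rw [edgeCount, edgeCount, edgeCount, ← hunion, sum_union hdisj, hunion, sum_congr rfl h1,
        sum_congr rfl h2, sum_add_distrib, hm]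
      ring
    have hcross : ∀ x ∈ lo, ∀ y ∈ hi', y i ≠ x i := by
      intro x hx y hy he
      rw [mem_filter] at hx hy
      exact hy.2 (he ▸ hx.2)
    have hm1 : m ≤ lo.card := by
      have : m ≤ lo.card • 1 := sum_le_card_nsmul _ _ _ fun x hx => card_le_one.2 fun y hy y' hy' => by
        rw [mem_inter, mem_upNbhd] at hy hy'
        exact eq_of_covBy_of_apply_ne hy.1 hy'.1 (hcross x hx y hy.2) (hcross x hx y' hy'.2)
      simpa using this
    have hm2 : m ≤ hi'.card := by
      rw [hm, sum_card_upNbhd_inter]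
      have : ∑ y ∈ hi', (downNbhd y ∩ lo).card ≤ hi'.card • 1 :=
        sum_le_card_nsmul _ _ _ fun y hy => card_le_one.2 fun x hx x' hx' => by
          rw [mem_inter, mem_downNbhd] at hx hx'
          exact eq_of_apply_ne_of_covBy hx.1 hx'.1 (hcross x hx.2 y hy) (hcross x' hx'.2 y hy)
      simpa using this
    calc 2 ^ edgeCount S = 2 ^ edgeCount lo * 2 ^ edgeCount hi' * 2 ^ m := by
          rw [hE, pow_add, pow_add]
      _ ≤ lo.card ^ lo.card * hi'.card ^ hi'.card * 2 ^ m :=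
          Nat.mul_le_mul_right _ (Nat.mul_le_mul (ih lo hloS) (ih hi' hhiS))
      _ ≤ (lo.card + hi'.card) ^ (lo.card + hi'.card) :=
          pow_self_mul_pow_self_mul_two_pow_le _ _ _ hm1 hm2
      _ = _ := by rw [hcard]

/-- Sets with small expansion are exponentially large. -/
lemma two_pow_le_of_card_nbhd_le (hn : 1 ≤ n) {C : Finset (Grid n)} (hC : C ⊆ layer n (n - 1))
    (hne : C.Nonempty) (hg : (C.biUnion upNbhd).card ≤ 2 * C.card) : 2 ^ n ≤ (3 * C.card) ^ 6 := by
  set S := C ∪ C.biUnion upNbhd with hS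
  have hSc : S.card ≤ 3 * C.card := (card_union_le _ _).trans (by omega)
  -- Points of `L_{n-1}` have at most `n / 2` twos, hence up-degree at least `n / 2`, and all these
  -- edges lie in `S`.
  have h1 : n * C.card ≤ 2 * edgeCount S := by
    have h2 : ∑ x ∈ C, (upNbhd x).card ≤ edgeCount S := by
      refine (sum_le_sum fun x hx => ?_).trans
        (sum_le_sum_of_subset (f := fun x => (upNbhd x ∩ S).card) (subset_union_left (s₁ := C)))
      exact card_le_card (subset_inter (subset_refl _)
        ((subset_biUnion_of_mem upNbhd hx).trans subset_union_right))
    have h3 : C.card • n ≤ ∑ x ∈ C, 2 * (upNbhd x).card := by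
      refine card_nsmul_le_sum _ _ _ fun x hx => ?_
      have h4 := card_upNbhd x
      have h5 := sum_add_countOf_zero x
      have h6 := countOf_add x
      rw [mem_layer.1 (hC hx)] at h5
      omega
    rw [← mul_sum, smul_eq_mul] at h3
    linarith
  have hpos := hne.card_pos
  have h2 : (2 ^ n) ^ C.card ≤ ((3 * C.card) ^ 6) ^ C.card := by
    calc (2 ^ n) ^ C.card = 2 ^ (n * C.card) := by rw [← pow_mul]
      _ ≤ 2 ^ (2 * edgeCount S) := Nat.pow_le_pow_right (by norm_num) h1
      _ = (2 ^ edgeCount S) ^ 2 := by rw [← pow_mul, mul_comm]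
      _ ≤ (S.card ^ S.card) ^ 2 := Nat.pow_le_pow_left (two_pow_edgeCount_le S) 2
      _ ≤ ((3 * C.card) ^ (3 * C.card)) ^ 2 := by
          refine Nat.pow_le_pow_left ?_ 2
          exact (Nat.pow_le_pow_left hSc _).trans (Nat.pow_le_pow_right (by omega) hSc)
      _ = _ := by rw [← pow_mul, ← pow_mul]; congr 1; ring
  exact (Nat.pow_le_pow_iff_left (by omega)).1 h2

/-- Few points of the grid have few coordinates different from `1`. -/
lemma card_few_ne_one_le :
    (((univ.filter fun y : Grid n => 500 * (univ.filter fun i => y i ≠ 1).card ≤ n).card : ℕ) : ℝ) ≤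
      (103 / 100 : ℝ) ^ n := by
  set Q := univ.filter fun y : Grid n => 500 * (univ.filter fun i => y i ≠ 1).card ≤ n with hQ
  -- An exponential moment: each coordinate different from `1` has weight `1 / 100`. Members of `Q`
  -- weigh at least `(102 / 103) ^ n` because `(102 / 103) ^ 500 ≤ 1 / 100`.
  have h1 : ∑ y : Grid n, ∏ i, (if y i ≠ 1 then (1 / 100 : ℝ) else 1) = (102 / 100 : ℝ) ^ n := by
    have h := prod_univ_sum (fun _ : Fin n => (univ : Finset (Fin 3)))
      (fun _ a => if a ≠ 1 then (1 / 100 : ℝ) else 1)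
    rw [Fintype.piFinset_univ] at h
    have h3 : ∑ a : Fin 3, (if a ≠ 1 then (1 / 100 : ℝ) else 1) = 102 / 100 := by
      rw [Fin.sum_univ_three, if_pos (by decide), if_neg (by decide), if_pos (by decide)]
      norm_num
    rw [← h]
    simp only [h3, prod_const, card_univ, Fintype.card_fin]
  have h2 : ∀ y ∈ Q, (102 / 103 : ℝ) ^ n ≤ ∏ i, (if y i ≠ 1 then (1 / 100 : ℝ) else 1) := by
    intro y hy
    rw [prod_ite, prod_const, prod_const_one, mul_one]
    generalize hr : (univ.filter fun i => y i ≠ 1).card = r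
    have hrn : 500 * r ≤ n := by rw [← hr]; exact (mem_filter.1 hy).2
    calc (102 / 103 : ℝ) ^ n ≤ (102 / 103 : ℝ) ^ (500 * r) :=
          pow_le_pow_of_le_one (by norm_num) (by norm_num) hrn
      _ = ((102 / 103 : ℝ) ^ 500) ^ r := pow_mul _ _ _
      _ ≤ (1 / 100 : ℝ) ^ r := by
          refine pow_le_pow_left₀ (by positivity) ?_ r
          have h10 : (102 / 103 : ℝ) ^ 250 ≤ 1 / 10 := by norm_num
          calc (102 / 103 : ℝ) ^ 500 = ((102 / 103 : ℝ) ^ 250) ^ 2 := by rw [← pow_mul]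
            _ ≤ (1 / 10) ^ 2 := pow_le_pow_left₀ (by positivity) h10 2
            _ = 1 / 100 := by norm_num
  have h3 : (Q.card : ℝ) * (102 / 103 : ℝ) ^ n ≤ (102 / 100 : ℝ) ^ n := by
    rw [← nsmul_eq_mul, ← h1]
    refine (card_nsmul_le_sum Q _ _ h2).trans
      (sum_le_sum_of_subset_of_nonneg (subset_univ _) fun y _ _ => ?_)
    exact prod_nonneg fun i _ => by split_ifs <;> norm_num
  rw [← le_div_iff₀ (by positivity), ← div_pow] at h3
  refine h3.trans (le_of_eq ?_)
  norm_num

lemma card_filter_ne_one (y : Grid n) :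
    (univ.filter fun i => y i ≠ 1).card = countOf 0 y + countOf 2 y := by
  have h1 := countOf_add y
  have h2 : countOf 1 y + (univ.filter fun i => y i ≠ 1).card = n := by
    have := card_filter_add_card_filter_not (s := (univ : Finset (Fin n))) (fun i => y i = 1)
    simpa [countOf] using this
  omega

/-- Vertex isoperimetry between the layers `n - 1` and `n`. -/
lemma card_nbhd_le_of_layer_sub_one (hn : 30 ≤ n) {C : Finset (Grid n)}
    (hC : C ⊆ layer n (n - 1)) :
    ((C.biUnion upNbhd).card : ℝ) ≤ 4004 * n * (((C.biUnion upNbhd).card : ℝ) - C.card) := by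
  have hlev := isLevel_layer (n := n) (k := n - 1) (by omega) (by omega) (by omega)
  have hn' : (30 : ℝ) ≤ n := by exact_mod_cast hn
  have hle := hlev.card_le_card_nbhd (by omega) hC
  rcases C.eq_empty_or_nonempty with rfl | hne
  · simp
  rcases lt_or_ge (2 * C.card) (C.biUnion upNbhd).card with hbig | hsmall
  · have h1 : 2 * (C.card : ℝ) ≤ (C.biUnion upNbhd).card := by exact_mod_cast hbig.le
    nlinarith
  have hexp := two_pow_le_of_card_nbhd_le (by omega) hC hne hsmall
  set G := C.biUnion upNbhd with hG
  set Q := univ.filter fun y : Grid n => 500 * (univ.filter fun i => y i ≠ 1).card ≤ n with hQ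
  have hGn : ∀ y ∈ G, ∑ i, (y i : ℕ) = n := by
    intro y hy
    obtain ⟨x, hx, hxy⟩ := mem_biUnion.1 hy
    rw [sum_of_covBy (mem_upNbhd.1 hxy), mem_layer.1 (hC hx)]
    omega
  -- Here `|G|` is at least `2 ^ (n / 6) / 3`, which outgrows `1.03 ^ n` since `1.03 ^ 6 ≤ 6 / 5`;
  -- the factor `(5 / 3) ^ n` absorbs the constants.
  have hQG : 2 * (Q.card : ℝ) ≤ G.card := by
    have h1 : (2 : ℝ) ^ n ≤ (3 * (G.card : ℝ)) ^ 6 := by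
      have h2 : (2 : ℝ) ^ n ≤ (3 * (C.card : ℝ)) ^ 6 := by exact_mod_cast hexp
      exact h2.trans (by gcongr)
    have h3 : (6 * (103 / 100 : ℝ) ^ n) ^ 6 ≤ 2 ^ n := by
      have h4 : (6 : ℝ) ^ 6 ≤ (5 / 3 : ℝ) ^ n := by
        calc (6 : ℝ) ^ 6 ≤ (5 / 3 : ℝ) ^ 30 := by norm_num
          _ ≤ _ := pow_le_pow_right₀ (by norm_num) hn
      calc (6 * (103 / 100 : ℝ) ^ n) ^ 6 = 6 ^ 6 * ((103 / 100 : ℝ) ^ 6) ^ n := by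
            rw [mul_pow, ← pow_mul, ← pow_mul, mul_comm n 6]
        _ ≤ (5 / 3 : ℝ) ^ n * (6 / 5 : ℝ) ^ n := by gcongr; norm_num
        _ = 2 ^ n := by rw [← mul_pow]; norm_num
    have h5 : 6 * (103 / 100 : ℝ) ^ n ≤ 3 * (G.card : ℝ) :=
      (pow_le_pow_iff_left₀ (by positivity) (by positivity) (by norm_num : 6 ≠ 0)).1 (h3.trans h1)
    have h6 : (Q.card : ℝ) ≤ (103 / 100 : ℝ) ^ n := card_few_ne_one_le
    linarith
  have h1 := hlev.sum_deficit_le (by omega) hC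
  have h2 : ((G \ Q).card : ℝ) * (1 / (1001 * (n + 1))) ≤
      ∑ y ∈ G, (1 - ∑ x ∈ downNbhd y, share upNbhd x) := by
    have h3 : ∀ y ∈ G, (countOf 2 y : ℝ) / (n * (n + 1)) ≤
        1 - ∑ x ∈ downNbhd y, share upNbhd x := fun y hy =>
      le_one_sub_sum_share (by omega) (hGn y hy)
    calc ((G \ Q).card : ℝ) * (1 / (1001 * (n + 1)))
        ≤ ∑ y ∈ G \ Q, (1 - ∑ x ∈ downNbhd y, share upNbhd x) := by
          rw [← nsmul_eq_mul]
          refine card_nsmul_le_sum _ _ _ fun y hy => ?_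
          rw [mem_sdiff] at hy
          refine le_trans ?_ (h3 y hy.1)
          -- In `L_n` zeros and twos are equally many, so more than `n / 500` coordinates different
          -- from `1` mean more than `n / 1000` twos.
          have h4 : n < 500 * (univ.filter fun i => y i ≠ 1).card := by
            by_contra! hle
            exact hy.2 (mem_filter.2 ⟨mem_univ _, hle⟩)
          have h5 := sum_add_countOf_zero y
          rw [hGn y hy.1] at h5
          rw [card_filter_ne_one] at h4
          have h6 : n ≤ 1001 * countOf 2 y := by omega
          have h7 : (n : ℝ) ≤ 1001 * countOf 2 y := by exact_mod_cast h6
          rw [div_le_div_iff₀ (by positivity) (by positivity)]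
          nlinarith
      _ ≤ _ := sum_le_sum_of_subset_of_nonneg sdiff_subset fun y hy _ =>
          le_trans (by positivity) (h3 y hy)
  have h4 : (G.card : ℝ) ≤ 2 * (G \ Q).card := by
    have h5 : G.card ≤ (G \ Q).card + Q.card := by
      have := card_sdiff_add_card_inter G Q
      have := card_le_card (inter_subset_right (s₁ := G) (s₂ := Q))
      omega
    have h6 : (G.card : ℝ) ≤ (G \ Q).card + Q.card := by exact_mod_cast h5
    linarith
  have h7 := h2.trans h1
  rw [mul_one_div, div_le_iff₀ (by positivity)] at h7
  nlinarith

end ThreeGrid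

/-! ### Hamming distance and linkedness. -/

namespace ThreeGrid

open Finset GraphContainer

variable {n : ℕ}

lemma hammingDist_le_one_of_covBy {v w : Grid n} (h : v ⋖ w) : hammingDist v w ≤ 1 := by
  obtain ⟨i, -, hj⟩ := covBy_iff.1 h
  have : (univ.filter fun j => v j ≠ w j) ⊆ {i} := by
    intro j hj'
    rw [mem_singleton]
    by_contra hne
    exact (mem_filter.1 hj').2 (hj j hne).symm
  exact card_le_card this

lemma hammingDist_le_length {v w : Grid n} (p : (SimpleGraph.hasse (Grid n)).Walk v w) :
    hammingDist v w ≤ p.length := by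
  induction p with
  | nil => simp
  | @cons a b c h p ih =>
    have h1 : hammingDist a b ≤ 1 := by
      rcases SimpleGraph.hasse_adj.1 h with h | h
      · exact hammingDist_le_one_of_covBy h
      · rw [hammingDist_comm]; exact hammingDist_le_one_of_covBy h
    have := hammingDist_triangle a b c
    rw [SimpleGraph.Walk.length_cons]
    omega

lemma hammingDist_le_of_graphPower_adj {k : ℕ} {v w : Grid n}
    (h : (graphPower (SimpleGraph.hasse (Grid n)) k).Adj v w) : hammingDist v w ≤ k := by
  have h2 : (SimpleGraph.hasse (Grid n)).edist v w ≤ k := h.2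
  obtain ⟨p, hp⟩ := SimpleGraph.exists_walk_of_edist_ne_top
    (ne_top_of_le_ne_top (ENat.natCast_ne_top k) h2)
  rw [← hp] at h2
  exact (hammingDist_le_length p).trans (by exact_mod_cast h2)

/-- The points at Hamming distance at most `k` from `x`. -/
def hammingBall (k : ℕ) (x : Grid n) : Finset (Grid n) := univ.filter fun y => hammingDist x y ≤ k

lemma card_hammingBall_le (hn : 0 < n) (k : ℕ) (x : Grid n) :
    (hammingBall k x).card ≤ (n * 3) ^ k := by
  induction k with
  | zero =>
    have : hammingBall 0 x = {x} := by
      ext y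
      simp [hammingBall, eq_comm]
    rw [this, card_singleton, pow_zero]
  | succ k ih =>
    have hsub : hammingBall (k + 1) x ⊆ (hammingBall k x).biUnion fun y =>
        (univ : Finset (Fin n × Fin 3)).image fun p => Function.update y p.1 p.2 := by
      intro y hy
      have hy' : hammingDist x y ≤ k + 1 := (mem_filter.1 hy).2
      rw [mem_biUnion]
      rcases Nat.lt_or_ge k (hammingDist x y) with hlt | hle
      · obtain ⟨i, hi⟩ := Function.ne_iff.1 (hammingDist_pos.1 (by omega : 0 < hammingDist x y))
        refine ⟨Function.update y i (x i), mem_filter.2 ⟨mem_univ _, ?_⟩,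
          mem_image.2 ⟨(i, y i), mem_univ _, by simp⟩⟩
        have hss : (univ.filter fun j => x j ≠ Function.update y i (x i) j) ⊂
            univ.filter fun j => x j ≠ y j := by
          refine (ssubset_iff_of_subset fun j hj => ?_).2 ⟨i, by simpa using hi, by simp⟩
          rw [mem_filter] at hj ⊢
          refine ⟨mem_univ _, fun he => hj.2 ?_⟩
          by_cases hji : j = i
          · subst hji; simp
          · rw [Function.update_of_ne hji, he]
        have := card_lt_card hss
        unfold hammingDist at hy' ⊢
        omega
      · exact ⟨y, mem_filter.2 ⟨mem_univ _, hle⟩,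
          mem_image.2 ⟨(⟨0, hn⟩, y ⟨0, hn⟩), mem_univ _, by simp⟩⟩
    refine (card_le_card hsub).trans ?_
    rw [pow_succ]
    refine (card_biUnion_le_card_mul _ _ (n * 3) fun y _ => card_image_le.trans ?_).trans
      (Nat.mul_le_mul_right _ ih)
    simp

/-- A set that is close to a 2-linked set in both directions is linked. -/
lemma linkedBy_of_near {A : Set (Grid n)} (hA : IsLinked (SimpleGraph.hasse (Grid n)) 2 A)
    {Z : Finset (Grid n)} (hZA : ∀ z ∈ Z, ∃ a ∈ A, hammingDist a z ≤ 3)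
    (hAZ : ∀ a ∈ A, ∃ z ∈ Z, hammingDist a z ≤ 3) :
    LinkedBy (fun x y => hammingDist x y ≤ 8) Z := by
  intro S hS hSne hSZ
  obtain ⟨s, hs⟩ := hSne
  obtain ⟨z, hz, hzS⟩ := exists_of_ssubset (hS.ssubset_of_ne hSZ)
  obtain ⟨a, haA, has⟩ := hZA s (hS hs)
  obtain ⟨b, hbA, hbz⟩ := hZA z hz
  -- A walk in `A` that leaves the points near `S` has a step crossing the boundary; its ends are
  -- near points of `S` and of `Z \ S`, at distance at most `3 + 2 + 3 = 8`.
  set near : Set A := {a | ∃ s ∈ S, hammingDist (a : Grid n) s ≤ 3} with hnear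
  by_cases hb : (⟨b, hbA⟩ : A) ∈ near
  · obtain ⟨s', hs', hbs'⟩ := hb
    refine ⟨s', hs', z, hz, hzS, ?_⟩
    have := hammingDist_triangle_left s' z b
    dsimp only at hbs'
    omega
  · obtain ⟨p⟩ := hA.preconnected ⟨a, haA⟩ ⟨b, hbA⟩
    obtain ⟨d, -, h1, h2⟩ := p.exists_boundary_dart near ⟨s, hs, has⟩ hb
    obtain ⟨s', hs', hds'⟩ := h1
    obtain ⟨z', hz', hdz'⟩ := hAZ d.toProd.2 d.toProd.2.2
    have hz'S : z' ∉ S := fun hc => h2 ⟨z', hc, hdz'⟩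
    refine ⟨s', hs', z', hz', hz'S, ?_⟩
    have hadj : hammingDist (d.toProd.1 : Grid n) d.toProd.2 ≤ 2 :=
      hammingDist_le_of_graphPower_adj d.adj
    have t1 := hammingDist_triangle s' (d.toProd.1 : Grid n) z'
    have t2 := hammingDist_triangle (d.toProd.1 : Grid n) d.toProd.2 z'
    rw [hammingDist_comm s' (d.toProd.1 : Grid n)] at t1
    omega

end ThreeGrid

/-! ### Certificates for pairs and the final count. -/

namespace ThreeGrid

open Finset GraphContainer

variable {n : ℕ}

lemma upNbhdSet_eq (S : Finset (Grid n)) : upNbhdSet S = S.biUnion upNbhd := by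
  ext; simp [upNbhdSet]

lemma upClosure_eq (k : ℕ) (A : Finset (Grid n)) :
    upClosure k A = GraphContainer.closure upNbhd (layer n k) A := by
  ext; simp [upClosure, GraphContainer.closure, upNbhdSet_eq]

/-- The certificate `P` describes the set `A` in the layer `k`, up to the approximation error. -/
def Describes (k : ℕ) (P : Fin 5 → Finset (Grid n)) (A : Finset (Grid n)) : Prop :=
  inner upNbhd downNbhd (layer n k) (n / (864 * Real.logb 2 n)) P ⊆ A.biUnion upNbhd ∧
  GraphContainer.closure upNbhd (layer n k) A ⊆
    outer upNbhd downNbhd (layer n k) (n / (864 * Real.logb 2 n)) P ∧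
  ((outer upNbhd downNbhd (layer n k) (n / (864 * Real.logb 2 n)) P).card : ℝ) ≤
    (inner upNbhd downNbhd (layer n k) (n / (864 * Real.logb 2 n)) P).card +
      (((A.biUnion upNbhd).card : ℝ) - (GraphContainer.closure upNbhd (layer n k) A).card) /
        (24 * Real.logb 2 n)

lemma one_le_logb (hn : 2 ≤ n) : 1 ≤ Real.logb 2 n := by
  have hn' : (2 : ℝ) ≤ n := by exact_mod_cast hn
  rw [Real.le_logb_iff_rpow_le (by norm_num) (by linarith)]
  simpa using hn'

lemma log_le_logb (n : ℕ) : Real.log n ≤ Real.logb 2 n := by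
  have h1 : 0 ≤ Real.log n := Real.log_natCast_nonneg n
  have h2 : Real.log 2 ≤ 1 := by linarith [Real.log_two_lt_d9]
  rw [Real.logb, le_div_iff₀ (Real.log_pos (by norm_num))]
  nlinarith

/-- Every set in the layers `n - 1` and `n - 2` has a short certificate close to it. -/
lemma exists_describes {k : ℕ} (hn : 6 ≤ n) (hk : k < n) (hk2 : n ≤ k + 2)
    {κ : ℝ} (hκ : 0 ≤ κ) {A : Finset (Grid n)} (hA : A ⊆ layer n k)
    (hgt : ((A.biUnion upNbhd).card : ℝ) ≤ κ * n * (((A.biUnion upNbhd).card : ℝ) -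
      (GraphContainer.closure upNbhd (layer n k) A).card)) :
    ∃ P : Fin 5 → Finset (Grid n), Describes k P A ∧
      (∀ i, ∀ z ∈ P i, ∃ y ∈ A.biUnion upNbhd, hammingDist y z ≤ 2) ∧
      (∀ a ∈ A, ∃ i, ∃ z ∈ P i, hammingDist a z ≤ 3) ∧
      ∑ i, ((P i).card : ℝ) ≤ (74 * κ + 10512) * ((((A.biUnion upNbhd).card : ℝ) -
        (GraphContainer.closure upNbhd (layer n k) A).card) * Real.logb 2 n / n) + 3 * n := by
  have hlev := isLevel_layer (n := n) (k := k) (by omega) hk hk2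
  have hCX : GraphContainer.closure upNbhd (layer n k) A ⊆ layer n k := filter_subset _ _
  -- The certificate is taken for `[A]`, which has the same upper neighbourhood as `A`.
  obtain ⟨P, h0, h1, h2, h3, h4, hcore, hsize, hin, hout, hcard⟩ := hlev.exists_certificate hn hCX
    (κ := κ) hκ (log_le_logb n) (one_le_logb (by omega)) (by rw [biUnion_closure hA]; exact hgt)
  rw [biUnion_closure hA] at h0 h2 h4 hsize hin hcard
  refine ⟨P, ⟨hin, hout, hcard⟩, ?_, ?_, hsize⟩
  · intro i z hz
    fin_cases i
    · exact ⟨z, h0 hz, by simp⟩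
    · obtain ⟨y, hy, hzy⟩ := mem_biUnion.1 (h1 hz)
      refine ⟨y, h0 hy, ?_⟩
      rw [hammingDist_comm]
      exact (hammingDist_le_one_of_covBy (mem_downNbhd.1 hzy)).trans (by norm_num)
    · exact ⟨z, h2 hz, by simp⟩
    · have hz' := mem_filter.1 (h3 hz)
      obtain ⟨y, hy⟩ := card_pos.1 (hlev.up_card_pos (by omega) hz'.1)
      refine ⟨y, hz'.2 hy, ?_⟩
      rw [hammingDist_comm]
      exact (hammingDist_le_one_of_covBy (mem_upNbhd.1 hy)).trans (by norm_num)
    · obtain ⟨x, -, hxz, y, hy⟩ := h4 z hz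
      rw [mem_inter] at hy
      refine ⟨y, hy.2, ?_⟩
      have e1 := hammingDist_le_one_of_covBy (mem_upNbhd.1 hxz)
      have e2 := hammingDist_le_one_of_covBy (mem_upNbhd.1 hy.1)
      have e3 := hammingDist_triangle_left y z x
      omega
  · intro a ha
    obtain ⟨y, hy⟩ := hcore a (subset_closure hA ha)
    rw [mem_inter, core, mem_union, mem_union] at hy
    have e1 := hammingDist_le_one_of_covBy (mem_upNbhd.1 hy.1)
    rcases hy.2 with (hy | hy) | hy
    · obtain ⟨x, hx, hxy⟩ := mem_biUnion.1 hy
      obtain ⟨z, hz, hxz⟩ := mem_biUnion.1 (mem_sdiff.1 hx).1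
      refine ⟨0, z, hz, ?_⟩
      have e2 := hammingDist_le_one_of_covBy (mem_upNbhd.1 hxy)
      have e3 := hammingDist_le_one_of_covBy (mem_downNbhd.1 hxz)
      have e4 := hammingDist_triangle_left y z x
      have e5 := hammingDist_triangle a y z
      omega
    · exact ⟨2, y, hy, by omega⟩
    · obtain ⟨z, hz, hzy⟩ := mem_biUnion.1 hy
      refine ⟨3, z, hz, ?_⟩
      have e2 := hammingDist_le_one_of_covBy (mem_upNbhd.1 hzy)
      have e3 := hammingDist_triangle_right a z y
      omega

open Classical in
/-- The admissible pairs of certificates: their union is linked and has at most `M` points. -/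
noncomputable def certificates (n M : ℕ) : Finset (Bool × Fin 5 → Finset (Grid n)) :=
  univ.filter fun P => (univ.biUnion P).Nonempty ∧ (univ.biUnion P).card ≤ M ∧
    LinkedBy (fun x y => hammingDist x y ≤ 8) (univ.biUnion P)

lemma mem_certificates {M : ℕ} {P : Bool × Fin 5 → Finset (Grid n)} :
    P ∈ certificates n M ↔ (univ.biUnion P).Nonempty ∧ (univ.biUnion P).card ≤ M ∧
      LinkedBy (fun x y => hammingDist x y ≤ 8) (univ.biUnion P) := by
  classical
  rw [certificates, mem_filter]
  simp only [mem_univ, true_and]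

lemma card_certificates_le (hn : 2 ≤ n) (M : ℕ) :
    ((certificates n M).card : ℝ) ≤ (2 : ℝ) ^ (2 * (n : ℝ) + 58 * Real.logb 2 n * M) := by
  have hn' : (2 : ℝ) ≤ n := by exact_mod_cast hn
  have hl1 := one_le_logb hn
  have h1 := card_linked_tuples_le (R := fun x y : Grid n => hammingDist x y ≤ 8)
    (fun x y h => by rw [hammingDist_comm]; exact h) (fun x => by simp)
    (ball := hammingBall 8) (fun v w h => mem_filter.2 ⟨mem_univ _, h⟩)
    (card_hammingBall_le (by omega) 8) M (certificates n M)
    (fun P hP => mem_certificates.1 hP)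
  have hcard : Fintype.card (Grid n) = 3 ^ n := by simp
  have hcard' : Fintype.card (Bool × Fin 5) = 10 := by simp
  rw [hcard, hcard'] at h1
  have h2 : ((certificates n M).card : ℝ) ≤
      3 ^ n * (((n : ℝ) * 3) ^ 8) ^ (2 * M) * 2 ^ (10 * M) := by exact_mod_cast h1
  refine h2.trans ?_
  have hnl : (2 : ℝ) ^ Real.logb 2 n = n :=
    Real.rpow_logb (by norm_num) (by norm_num) (by linarith)
  set l := Real.logb 2 n with hl
  have e1 : (3 : ℝ) ^ n ≤ (2 : ℝ) ^ (2 * (n : ℝ)) := by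
    rw [Real.rpow_mul (by norm_num), Real.rpow_natCast]
    exact pow_le_pow_left₀ (by norm_num) (by norm_num) n
  have e2 : (((n : ℝ) * 3) ^ 8) ^ (2 * M) ≤ (2 : ℝ) ^ ((l + 2) * (16 * M)) := by
    have e3 : (n : ℝ) * 3 ≤ (2 : ℝ) ^ (l + 2) := by
      rw [Real.rpow_add (by norm_num), hnl]
      norm_num
      linarith
    calc (((n : ℝ) * 3) ^ 8) ^ (2 * M) = ((n : ℝ) * 3) ^ (16 * M) := by
          rw [← pow_mul]; congr 1; ring
      _ ≤ ((2 : ℝ) ^ (l + 2)) ^ (16 * M) := pow_le_pow_left₀ (by positivity) e3 _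
      _ = _ := by rw [← Real.rpow_natCast, ← Real.rpow_mul (by norm_num)]; push_cast; rfl
  have e4 : (2 : ℝ) ^ (10 * M) = (2 : ℝ) ^ (10 * (M : ℝ)) := by
    rw [← Real.rpow_natCast]; push_cast; rfl
  calc (3 : ℝ) ^ n * (((n : ℝ) * 3) ^ 8) ^ (2 * M) * 2 ^ (10 * M)
      ≤ (2 : ℝ) ^ (2 * (n : ℝ)) * (2 : ℝ) ^ ((l + 2) * (16 * M)) * (2 : ℝ) ^ (10 * (M : ℝ)) := by
        rw [e4]; gcongr
    _ = (2 : ℝ) ^ (2 * (n : ℝ) + (l + 2) * (16 * M) + 10 * M) := by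
        rw [← Real.rpow_add (by norm_num), ← Real.rpow_add (by norm_num)]
    _ ≤ _ := by
        -- The coefficient of `M` is `16 * (l + 2) + 10 ≤ 58 * l`, as `l ≥ 1`.
        refine Real.rpow_le_rpow_of_exponent_le (by norm_num) ?_
        have hM : (0 : ℝ) ≤ M := by positivity
        nlinarith

/-- The number of pairs with given parameters that are described by a given pair of
certificates. -/
lemma card_described_le {a b g h : ℕ} (hn : 6 ≤ n) (hn2 : 16 * (4004 : ℝ) ≤ n) (hbh : b ≤ h)
    (hag : a ≤ g) (P Q : Fin 5 → Finset (Grid n))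
    (𝒟 : Finset (Finset (Grid n) × Finset (Grid n)))
    (h𝒟 : ∀ D ∈ 𝒟, D ∈ containerPairs n a b g h ∧
      Describes (n - 1) P D.1 ∧ Describes (n - 2) Q D.2)
    (hgt : (g : ℝ) ≤ 4004 * n * ((g : ℝ) - a)) (hht : (h : ℝ) ≤ 4004 * n * ((h : ℝ) - b)) :
    (𝒟.card : ℝ) ≤ (2 : ℝ) ^ ((g : ℝ) -
      (((g : ℝ) - a) + ((h : ℝ) - b)) / (24 * Real.logb 2 n)) := by
  rcases 𝒟.eq_empty_or_nonempty with rfl | ⟨D₀, hD₀⟩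
  · simp only [card_empty, Nat.cast_zero]; positivity
  have hmem : ∀ D ∈ 𝒟, D.1 ⊆ layer n (n - 1) ∧ D.2 ⊆ layer n (n - 2) ∧
      (GraphContainer.closure upNbhd (layer n (n - 1)) D.1).card = a ∧
      (GraphContainer.closure upNbhd (layer n (n - 2)) D.2).card = b ∧
      (D.1.biUnion upNbhd).card = g ∧ (D.2.biUnion upNbhd).card = h ∧
      D.2.biUnion upNbhd ⊆ D.1 := by
    intro D hD
    have := (h𝒟 D hD).1
    simp only [containerPairs, mem_filter, mem_product, mem_powerset, upNbhdSet_eq,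
      upClosure_eq] at this
    tauto
  have hlev := isLevel_layer (n := n) (k := n - 1) (by omega) (by omega) (by omega)
  have hlev' := isLevel_layer (n := n) (k := n - 2) (by omega) (by omega) (by omega)
  obtain ⟨-, ⟨-, -, hP⟩, -, -, hQ⟩ := h𝒟 D₀ hD₀
  obtain ⟨-, -, ha₀, hb₀, hg₀, hh₀, -⟩ := hmem D₀ hD₀
  rw [ha₀, hg₀] at hP
  rw [hb₀, hh₀] at hQ
  have hB : ((𝒟.image Prod.snd).card : ℝ) ≤
      (2 : ℝ) ^ ((h : ℝ) - (∅ : Finset (Grid n)).card - ((h : ℝ) - b) / (24 * Real.logb 2 n)) := by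
    refine card_approximated_le (up := upNbhd) (X := layer n (n - 2)) (n := n)
      (fun x hx => hlev'.up_card_le x hx) (sdiff_subset.trans (filter_subset _ _)) hbh hn2
      (by omega) rfl hht hQ _ ?_
    intro B hB
    obtain ⟨D, hD, rfl⟩ := mem_image.1 hB
    obtain ⟨-, h1, -, h2, -, h3, -⟩ := hmem D hD
    obtain ⟨-, -, h4, h5, -⟩ := h𝒟 D hD
    exact ⟨h1, empty_subset _, h2, h3, h4, h5⟩
  -- For fixed `B` the set `H = N⁺(B)` of size `h` is forced into `A`; this cancels the factor `2 ^
  -- h` in the count of the sets `B`.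
  have hA : ∀ B ∈ 𝒟.image Prod.snd, (𝒟.filter fun D => D.2 = B).card ≤
      ⌊(2 : ℝ) ^ ((g : ℝ) - h - ((g : ℝ) - a) / (24 * Real.logb 2 n))⌋₊ := by
    intro B hB
    obtain ⟨D₁, hD₁, rfl⟩ := mem_image.1 hB
    obtain ⟨-, -, -, -, -, hh₁, -⟩ := hmem D₁ hD₁
    refine Nat.le_floor ?_
    have h1 : (𝒟.filter fun D => D.2 = D₁.2).card =
        ((𝒟.filter fun D => D.2 = D₁.2).image Prod.fst).card := by
      refine (card_image_of_injOn fun D hD D' hD' he => ?_).symm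
      exact Prod.ext he ((mem_filter.1 hD).2.trans (mem_filter.1 hD').2.symm)
    rw [h1, ← hh₁]
    refine card_approximated_le (up := upNbhd) (X := layer n (n - 1)) (n := n)
      (fun x hx => hlev.up_card_le x hx) (sdiff_subset.trans (filter_subset _ _)) hag hn2
      (by omega) rfl hgt hP _ ?_
    intro A hA
    obtain ⟨D, hD, rfl⟩ := mem_image.1 hA
    rw [mem_filter] at hD
    obtain ⟨h1, -, h2, -, h3, -, h6⟩ := hmem D hD.1
    obtain ⟨-, ⟨h4, h5, -⟩, -⟩ := h𝒟 D hD.1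
    exact ⟨h1, hD.2 ▸ h6, h2, h3, h4, h5⟩
  have hcount := card_le_mul_card_image_of_maps_to (f := Prod.snd)
    (fun D hD => mem_image_of_mem Prod.snd hD) _ hA
  rw [card_empty, Nat.cast_zero, sub_zero] at hB
  calc (𝒟.card : ℝ) ≤ ⌊(2 : ℝ) ^ ((g : ℝ) - h - ((g : ℝ) - a) / (24 * Real.logb 2 n))⌋₊ *
        (𝒟.image Prod.snd).card := by exact_mod_cast hcount
    _ ≤ (2 : ℝ) ^ ((g : ℝ) - h - ((g : ℝ) - a) / (24 * Real.logb 2 n)) *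
        (2 : ℝ) ^ ((h : ℝ) - ((h : ℝ) - b) / (24 * Real.logb 2 n)) := by
        gcongr
        exact Nat.floor_le (by positivity)
    _ = _ := by
        rw [← Real.rpow_add (by norm_num)]
        congr 1
        ring

lemma mem_containerPairs {a b g h : ℕ} {A B : Finset (Grid n)} :
    (A, B) ∈ containerPairs n a b g h ↔ A ⊆ layer n (n - 1) ∧ B ⊆ layer n (n - 2) ∧
      IsLinked (SimpleGraph.hasse (Grid n)) 2 (A : Set (Grid n)) ∧
      (GraphContainer.closure upNbhd (layer n (n - 1)) A).card = a ∧
      (GraphContainer.closure upNbhd (layer n (n - 2)) B).card = b ∧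
      (A.biUnion upNbhd).card = g ∧ (B.biUnion upNbhd).card = h ∧ B.biUnion upNbhd ⊆ A := by
  simp only [containerPairs, mem_filter, mem_product, mem_powerset, upNbhdSet_eq, upClosure_eq]
  tauto

lemma expansion_of_mem_containerPairs {a b g h : ℕ} (hn : 30 ≤ n) {A B : Finset (Grid n)}
    (hAB : (A, B) ∈ containerPairs n a b g h) :
    (g : ℝ) ≤ 4004 * n * ((g : ℝ) - a) ∧ (h : ℝ) ≤ 4004 * n * ((h : ℝ) - b) := by
  obtain ⟨hA, hB, -, ha, hb, hg, hh, -⟩ := mem_containerPairs.1 hAB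
  constructor
  · have := card_nbhd_le_of_layer_sub_one hn
      (C := GraphContainer.closure upNbhd (layer n (n - 1)) A) (filter_subset _ _)
    rwa [biUnion_closure hA, ha, hg] at this
  · have := card_nbhd_le_of_layer_sub_two (n := n) (k := n - 2) (by omega) (by omega)
      (C := GraphContainer.closure upNbhd (layer n (n - 2)) B) (filter_subset _ _)
    rw [biUnion_closure hB, hb, hh] at this
    have h0 : (0 : ℝ) ≤ h := by positivity
    linarith

/-- `B` itself need not be linked, but its certificate lies within distance `2` of `N⁺(B) ⊆ A`, so
the union of both certificates is near `A`. The constant is `306808 = 74 * 4004 + 10512`. -/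
lemma exists_mem_certificates {a b g h M : ℕ} (hn : 30 ≤ n)
    (hM : 306808 * ((((g : ℝ) - a) + ((h : ℝ) - b)) * Real.logb 2 n / n) + 6 * n ≤ M)
    {A B : Finset (Grid n)} (hAB : (A, B) ∈ containerPairs n a b g h) :
    ∃ P ∈ certificates n M, Describes (n - 1) (fun i => P (true, i)) A ∧
      Describes (n - 2) (fun i => P (false, i)) B := by
  obtain ⟨hgt, hht⟩ := expansion_of_mem_containerPairs hn hAB
  obtain ⟨hA, hB, hlink, ha, hb, hg, hh, hBA⟩ := mem_containerPairs.1 hAB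
  obtain ⟨P, hP, hPA, hAP, hPc⟩ := exists_describes (k := n - 1) (κ := 4004) (by omega) (by omega)
    (by omega) (by norm_num) hA (by rw [hg, ha]; exact hgt)
  obtain ⟨Q, hQ, hQB, -, hQc⟩ := exists_describes (k := n - 2) (κ := 4004) (by omega) (by omega)
    (by omega) (by norm_num) hB (by rw [hh, hb]; exact hht)
  rw [ha, hg] at hPc
  rw [hb, hh] at hQc
  set R : Bool × Fin 5 → Finset (Grid n) := fun p => bif p.1 then P p.2 else Q p.2 with hR
  have hAZ : ∀ a ∈ (A : Set (Grid n)), ∃ z ∈ univ.biUnion R, hammingDist a z ≤ 3 := by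
    intro x hx
    obtain ⟨i, z, hz, hxz⟩ := hAP x hx
    exact ⟨z, mem_biUnion.2 ⟨(true, i), mem_univ _, hz⟩, hxz⟩
  refine ⟨R, mem_certificates.2 ⟨?_, ?_, linkedBy_of_near hlink ?_ hAZ⟩, hP, hQ⟩
  · obtain ⟨⟨x, hx⟩⟩ := hlink.nonempty
    obtain ⟨z, hz, -⟩ := hAZ x hx
    exact ⟨z, hz⟩
  · have h1 : (univ.biUnion R).card ≤ ∑ p, (R p).card := card_biUnion_le
    have h2 : ∑ p, (R p).card = ∑ i, (P i).card + ∑ i, (Q i).card := by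
      rw [Fintype.sum_prod_type, Fintype.sum_bool]
      rfl
    have h3 : ((univ.biUnion R).card : ℝ) ≤ ∑ i, ((P i).card : ℝ) + ∑ i, ((Q i).card : ℝ) := by
      rw [h2] at h1
      exact_mod_cast h1
    have h4 : (((g : ℝ) - a) + ((h : ℝ) - b)) * Real.logb 2 n / n =
      ((g : ℝ) - a) * Real.logb 2 n / n + ((h : ℝ) - b) * Real.logb 2 n / n := by ring
    have h5 : ((univ.biUnion R).card : ℝ) ≤ M := by
      rw [h4] at hM
      linarith
    exact_mod_cast h5
  · intro z hz
    obtain ⟨⟨c, i⟩, -, hz⟩ := mem_biUnion.1 hz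
    cases c with
    | true =>
      obtain ⟨y, hy, hyz⟩ := hPA i z hz
      obtain ⟨x, hx, hxy⟩ := mem_biUnion.1 hy
      refine ⟨x, hx, ?_⟩
      have e1 := hammingDist_le_one_of_covBy (mem_upNbhd.1 hxy)
      have e2 := hammingDist_triangle x y z
      omega
    | false =>
      obtain ⟨y, hy, hyz⟩ := hQB i z hz
      exact ⟨y, hBA hy, by omega⟩

/-- The gain `g - a` is at least `n ^ 2`. -/
lemma sq_le_gain {a b g h : ℕ} (hn : 30 ≤ n) (hbig : (12012 * (n : ℝ) ^ 3) ^ 6 < 2 ^ n)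
    (hag : a ≤ g) (hna : n ^ 2 ≤ a) {A B : Finset (Grid n)}
    (hAB : (A, B) ∈ containerPairs n a b g h) : (n : ℝ) ^ 2 ≤ (g : ℝ) - a := by
  have hna' : (n : ℝ) ^ 2 ≤ a := by exact_mod_cast hna
  rcases lt_or_ge (2 * a) g with hlt | hle
  · have : 2 * (a : ℝ) ≤ g := by exact_mod_cast hlt.le
    linarith
  -- A gain below `n²` would force `a ≤ g ≤ 4004 * n ^ 3`, although a set expanding by at most a
  -- factor `2` is exponentially large.
  by_contra! hsmall
  obtain ⟨hgt, -⟩ := expansion_of_mem_containerPairs hn hAB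
  obtain ⟨hA, -, -, ha, -, hg, -⟩ := mem_containerPairs.1 hAB
  have ha0 : 0 < a := lt_of_lt_of_le (by positivity) hna
  have h1 := two_pow_le_of_card_nbhd_le (n := n) (by omega)
    (C := GraphContainer.closure upNbhd (layer n (n - 1)) A) (filter_subset _ _)
    (card_pos.1 (by omega)) (by rw [biUnion_closure hA, ha, hg]; exact hle)
  rw [ha] at h1
  have h2 : (2 : ℝ) ^ n ≤ (3 * (a : ℝ)) ^ 6 := by exact_mod_cast h1
  have hag' : (a : ℝ) ≤ g := by exact_mod_cast hag
  have h3 : 3 * (a : ℝ) ≤ 12012 * (n : ℝ) ^ 3 := by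
    have : 4004 * (n : ℝ) * ((g : ℝ) - a) ≤ 4004 * n * (n : ℝ) ^ 2 := by gcongr
    nlinarith
  have h4 : (3 * (a : ℝ)) ^ 6 ≤ (12012 * (n : ℝ) ^ 3) ^ 6 := by gcongr
  linarith

/-- The first bound makes the certificates cheap compared with the saving; the second serves
`sq_le_gain`. -/
lemma eventually_large : ∀ᶠ n : ℕ in Filter.atTop,
    2000000000 * Real.logb 2 n ^ 3 ≤ n ∧ (12012 * (n : ℝ) ^ 3) ^ 6 < 2 ^ n := by
  refine Filter.Eventually.and ?_ ?_
  · have h1 := ((Real.isLittleO_pow_log_id_atTop (n := 3)).comp_tendsto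
      tendsto_natCast_atTop_atTop).bound
      (c := Real.log 2 ^ 3 / 2000000000) (by have := Real.log_pos one_lt_two; positivity)
    filter_upwards [h1] with n hn
    have h2 : 0 < Real.log 2 := Real.log_pos one_lt_two
    simp only [Function.comp_apply, id, Real.norm_natCast] at hn
    have h3 := (le_abs_self _).trans hn
    rw [Real.logb, div_pow, ← mul_div_assoc, div_le_iff₀ (by positivity)]
    linarith
  · have h1 := (tendsto_pow_const_div_const_pow_of_one_lt 18 (one_lt_two (α := ℝ))).eventually
      (gt_mem_nhds (show (0 : ℝ) < 1 / 12012 ^ 6 by positivity))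
    filter_upwards [h1] with n hn
    rw [div_lt_div_iff₀ (by positivity) (by positivity)] at hn
    calc (12012 * (n : ℝ) ^ 3) ^ 6 = (n : ℝ) ^ 18 * 12012 ^ 6 := by ring
      _ < _ := by linarith

end ThreeGrid

open ThreeGrid in
theorem lemma4p9 :
    ∃ c : ℝ, 0 < c ∧ ∃ n₀ : ℕ, 2 ≤ n₀ ∧ ∀ n : ℕ, n₀ ≤ n → ∀ a b g h : ℕ,
      b ≤ h → h ≤ a → a ≤ g → n ^ 2 ≤ a →
        ((ThreeGrid.containerPairs n a b g h).card : ℝ) ≤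
          (2 : ℝ) ^ ((g : ℝ) - c * ((((g : ℝ) - a) + ((h : ℝ) - b)) / Real.logb 2 n)) := by
  classical
  obtain ⟨N, hN⟩ := Filter.eventually_atTop.1 eventually_large
  -- Half of the saving `1 / 24` is spent on the certificates; `64064 = 16 * 4004` is the size
  -- required by `card_described_le`.
  refine ⟨1 / 48, by norm_num, max N 64064, by omega, ?_⟩
  intro n hn a b g h hbh _ hag hna
  have hn1 : 64064 ≤ n := (le_max_right _ _).trans hn
  have hnR : (64064 : ℝ) ≤ n := by exact_mod_cast hn1
  obtain ⟨hlog, hbig⟩ := hN n ((le_max_left _ _).trans hn)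
  have hl1 : 1 ≤ Real.logb 2 n := one_le_logb (by omega)
  rcases (containerPairs n a b g h).eq_empty_or_nonempty with he | ⟨⟨A₀, B₀⟩, hAB₀⟩
  · rw [he]; simp only [Finset.card_empty, Nat.cast_zero]; positivity
  obtain ⟨hgt, hht⟩ := expansion_of_mem_containerPairs (by omega) hAB₀
  have hgain := sq_le_gain (by omega) hbig hag hna hAB₀
  have hbh' : (b : ℝ) ≤ h := by exact_mod_cast hbh
  set l := Real.logb 2 n with hl
  set τ := ((g : ℝ) - a) + ((h : ℝ) - b) with hτ
  have hτn : (n : ℝ) ^ 2 ≤ τ := by linarith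
  have hτ0 : 0 ≤ τ := le_trans (by positivity) hτn
  obtain ⟨M, hM, hM'⟩ : ∃ M : ℕ, 306808 * (τ * l / n) + 6 * n ≤ M ∧
      (M : ℝ) ≤ 306808 * (τ * l / n) + 6 * n + 1 :=
    ⟨_, Nat.le_ceil _, (Nat.ceil_lt_add_one (by positivity)).le⟩
  have hsub : containerPairs n a b g h ⊆ (certificates n M).biUnion fun P =>
      (containerPairs n a b g h).filter fun D =>
        Describes (n - 1) (fun i => P (true, i)) D.1 ∧
          Describes (n - 2) (fun i => P (false, i)) D.2 := by
    rintro ⟨A, B⟩ hAB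
    obtain ⟨P, hP, hPA, hPB⟩ := exists_mem_certificates (by omega) hM hAB
    exact Finset.mem_biUnion.2 ⟨P, hP, Finset.mem_filter.2 ⟨hAB, hPA, hPB⟩⟩
  have hfib : ∀ P ∈ certificates n M, ((containerPairs n a b g h).filter fun D =>
        Describes (n - 1) (fun i => P (true, i)) D.1 ∧
          Describes (n - 2) (fun i => P (false, i)) D.2).card ≤
      ⌊(2 : ℝ) ^ ((g : ℝ) - τ / (24 * l))⌋₊ := by
    intro P _
    refine Nat.le_floor (card_described_le (by omega) (by linarith) hbh hag
      (fun i => P (true, i)) (fun i => P (false, i)) _ ?_ hgt hht)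
    intro D hD
    exact Finset.mem_filter.1 hD
  have hcount := (Finset.card_le_card hsub).trans (Finset.card_biUnion_le_card_mul _ _ _ hfib)
  -- The part proportional to `τ` is absorbed because `n` dominates `l ^ 3`. The remainder is at
  -- most `408 * l * n`, with `408 = 2 + 58 * 7`, and is absorbed because `τ ≥ n ^ 2`.
  have hexp : 2 * (n : ℝ) + 58 * l * M ≤ τ / (48 * l) := by
    have hn0 : (0 : ℝ) < n := by linarith
    have hl0 : 0 < l := by linarith
    have h1 : 58 * l * (M : ℝ) ≤ 58 * l * (306808 * (τ * l / n) + 6 * n + 1) := by gcongr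
    have h2 : 58 * l * (306808 * (τ * l / n)) ≤ τ / (96 * l) := by
      rw [le_div_iff₀ (by positivity)]
      calc 58 * l * (306808 * (τ * l / n)) * (96 * l) = 1708306944 * l ^ 3 * (τ / n) := by ring
        _ ≤ n * (τ / n) := by
            have : 0 ≤ l ^ 3 := by positivity
            gcongr
            linarith
        _ = τ := by field_simp
    have h3 : 408 * l * n ≤ τ / (96 * l) := by
      rw [le_div_iff₀ (by positivity)]
      have h4 : l ^ 2 ≤ l ^ 3 := pow_le_pow_right₀ hl1 (by norm_num)
      calc 408 * l * n * (96 * l) = 39168 * l ^ 2 * n := by ring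
        _ ≤ n * n := by
            gcongr
            nlinarith
        _ ≤ τ := by linarith
    have h5 : τ / (96 * l) + τ / (96 * l) = τ / (48 * l) := by field_simp; ring
    nlinarith
  calc ((containerPairs n a b g h).card : ℝ)
      ≤ (certificates n M).card * ⌊(2 : ℝ) ^ ((g : ℝ) - τ / (24 * l))⌋₊ := by
        exact_mod_cast hcount
    _ ≤ (2 : ℝ) ^ (2 * (n : ℝ) + 58 * l * M) * (2 : ℝ) ^ ((g : ℝ) - τ / (24 * l)) := by
        gcongr
        · exact card_certificates_le (by omega) M
        · exact Nat.floor_le (by positivity)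
    _ = (2 : ℝ) ^ (2 * (n : ℝ) + 58 * l * M + ((g : ℝ) - τ / (24 * l))) := by
        rw [← Real.rpow_add (by norm_num)]
    _ ≤ _ := by
        refine Real.rpow_le_rpow_of_exponent_le (by norm_num) ?_
        have h1 : τ / (24 * l) = τ / (48 * l) + 1 / 48 * (τ / l) := by field_simp; ring
        linarith
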